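/- Let $G=(U,V;E)$ be a bipartite graph with $|U|=|V|=n\ge 1$ that has a perfect matching. Given a permutation $\sigma$ of $U$ and a permutation $\pi$ of $V$, the greedy matching $M_G[\sigma,\pi]$ is obtained as follows: the vertices of $U$ arrive in the order $\sigma$, and each arriving vertex $u$ is matched to the lowest vertex under $\pi$ among its neighbors in $V$ that are not yet matched ($u$ stays unmatched if there is none). Let $\rho[G]=\frac1n\max_{\pi}\min_{\sigma}|M_G[\sigma,\pi]|$, and let $\rho=\inf_G\rho[G]$, over all such graphs $G$ and all $n\ge 1$. **Theorem 1.** For every such graph $G$ there is a permutation $\pi$ of $V$ such that, for every permutation $\sigma$ of $U$, $$|M_G[\sigma,\pi]|\ \ge\ \Bigl(\tfrac12+\tfrac1{86}\Bigr)n .$$ That is, $\rho[G]\ge\frac12+\frac1{86}$ for every such $G$, and so $\rho\ge\frac12+\frac1{86}>0.51$. Moreover, such a permutation $\pi$ can be computed in polynomial time: there are one algorithm and one polynomial $p$ such that, for every $n$ and every such graph $G$, given $n$ and the adjacency matrix of $G$, the algorithm outputs within $p(n)$ steps a permutation $\pi$ with $|M_G[\sigma,\pi]|\ge(\frac12+\frac1{86})n$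 for all $\sigma$. -/

import Mathlib

namespace MaxMinGreedy

section Greedy

variable {U V : Type*} [DecidableEq U] [DecidableEq V]

/-- The bipartite graph `G(U, V; E)`, given by its edge set `E`, has a perfect matching. -/
def HasPerfectMatching (E : Finset (U × V)) : Prop :=
  ∃ M : U ≃ V, ∀ u : U, (u, M u) ∈ E

/-- One arrival: `u` is matched to the lowest vertex under `π` among its neighbors in `V` that are
not yet matched by `M`; `u` stays unmatched if there is none. The permutation `π` lists the
vertices of `V` from the lowest (`π 0`) to the highest. -/
def greedyStep {m : ℕ} (E : Finset (U × V)) (π : Fin m ≃ V) (M : Finset (U × V)) (u : U) :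
    Finset (U × V) :=
  match (List.ofFn π).find? (fun v => decide ((u, v) ∈ E ∧ ∀ e ∈ M, e.2 ≠ v)) with
  | some v => insert (u, v) M
  | none => M

/-- The greedy matching `M_G[σ, π]`: the vertices of `U` arrive in the order
`σ 0, σ 1, …`. -/
def greedyMatching {l m : ℕ} (E : Finset (U × V)) (σ : Fin l ≃ U) (π : Fin m ≃ V) :
    Finset (U × V) :=
  (List.ofFn σ).foldl (greedyStep E π) ∅

/-- `ρ[G] = (1 / n) max_π min_σ |M_G[σ, π]|`, where `n = |V|`. (The supremum and the infimum are
over finite nonempty types, so they are a maximum and a minimum.) -/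
noncomputable def rhoGraph [Fintype U] [Fintype V] (E : Finset (U × V)) : ℝ :=
  ((⨆ π : Fin (Fintype.card V) ≃ V, ⨅ σ : Fin (Fintype.card U) ≃ U,
    (greedyMatching E σ π).card : ℕ) : ℝ) / (Fintype.card V : ℝ)

end Greedy

/-- `ρ`, the infimum of `ρ[G]` over all bipartite graphs `G` with `n ≥ 1` vertices on each side
that have a perfect matching. -/
noncomputable def rho : ℝ :=
  sInf {r : ℝ | ∃ (n : ℕ) (E : Finset (Fin n × Fin n)),
    0 < n ∧ HasPerfectMatching E ∧ r = rhoGraph E}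

/-! ### A random access machine with a step count

Programs are structured programs of a random access machine over the natural numbers. The machine
has registers, numbered by `ℕ`, and arrays, numbered by `ℕ`, with cells numbered by `ℕ`; a program
names finitely many registers and arrays, and addresses the cells of an array by computed indices.
The only arithmetic operations are addition and truncated subtraction (no multiplication), so the
number of binary digits of the largest number in the machine grows by at most one in each elementary
step; hence, up to a polynomial, the step count below is the running time of a Turing machine. -/

/-- A memory state of the machine. -/
structure State where
  /-- the contents of the registers -/
  reg : ℕ → ℕ
  /-- the contents of the arrays: `arr a i` is cell `i` of array `a` -/
  arr : ℕ → ℕ → ℕ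

/-- Arithmetic expressions. -/
inductive Exp where
  /-- a constant -/
  | lit (k : ℕ)
  /-- the contents of register `x` -/
  | reg (x : ℕ)
  /-- the contents of the cell of array `a` whose index is the value of `i` -/
  | get (a : ℕ) (i : Exp)
  /-- a sum -/
  | add (e₁ e₂ : Exp)
  /-- a truncated difference -/
  | sub (e₁ e₂ : Exp)

/-- The value of an expression. -/
def Exp.eval (s : State) : Exp → ℕ
  | .lit k => k
  | .reg x => s.reg x
  | .get a i => s.arr a (i.eval s)
  | .add e₁ e₂ => e₁.eval s + e₂.eval s
  | .sub e₁ e₂ => e₁.eval s - e₂.eval s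

/-- The number of elementary steps that the evaluation of an expression takes. -/
def Exp.cost : Exp → ℕ
  | .lit _ => 1
  | .reg _ => 1
  | .get _ i => i.cost + 1
  | .add e₁ e₂ => e₁.cost + e₂.cost + 1
  | .sub e₁ e₂ => e₁.cost + e₂.cost + 1

/-- Programs. A condition holds when its value is not `0`. -/
inductive Prog where
  /-- do nothing -/
  | skip
  /-- write the value of `e` into register `x` -/
  | assign (x : ℕ) (e : Exp)
  /-- write the value of `e` into the cell of array `a` whose index is the value of `i` -/
  | store (a : ℕ) (i e : Exp)
  /-- first `c₁`, then `c₂` -/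
  | seq (c₁ c₂ : Prog)
  /-- `c₁` if the condition `b` holds, else `c₂` -/
  | cond (b : Exp) (c₁ c₂ : Prog)
  /-- repeat `c` as long as the condition `b` holds -/
  | loop (b : Exp) (c : Prog)

/-- `Exec c s t s'`: the program `c`, started in the state `s`, halts after exactly `t` elementary
steps, in the state `s'`. -/
inductive Exec : Prog → State → ℕ → State → Prop
  | skip (s : State) : Exec .skip s 1 s
  | assign (x : ℕ) (e : Exp) (s : State) :
      Exec (.assign x e) s (e.cost + 1)
        { s with reg := Function.update s.reg x (e.eval s) }
  | store (a : ℕ) (i e : Exp) (s : State) :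
      Exec (.store a i e) s (i.cost + e.cost + 1)
        { s with arr :=
            Function.update s.arr a (Function.update (s.arr a) (i.eval s) (e.eval s)) }
  | seq {c₁ c₂ : Prog} {s s' s'' : State} {t₁ t₂ : ℕ} :
      Exec c₁ s t₁ s' → Exec c₂ s' t₂ s'' → Exec (.seq c₁ c₂) s (t₁ + t₂) s''
  | cond_true {b : Exp} {c₁ c₂ : Prog} {s s' : State} {t : ℕ} :
      b.eval s ≠ 0 → Exec c₁ s t s' → Exec (.cond b c₁ c₂) s (b.cost + 1 + t) s'
  | cond_false {b : Exp} {c₁ c₂ : Prog} {s s' : State} {t : ℕ} :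
      b.eval s = 0 → Exec c₂ s t s' → Exec (.cond b c₁ c₂) s (b.cost + 1 + t) s'
  | loop_true {b : Exp} {c : Prog} {s s' s'' : State} {t₁ t₂ : ℕ} :
      b.eval s ≠ 0 → Exec c s t₁ s' → Exec (.loop b c) s' t₂ s'' →
        Exec (.loop b c) s (b.cost + 1 + t₁ + t₂) s''
  | loop_false {b : Exp} {c : Prog} {s : State} :
      b.eval s = 0 → Exec (.loop b c) s (b.cost + 1) s

/-- The input state for a bipartite graph with `n` vertices on each side: register `0` holds `n`,
array `0` holds the `n × n` adjacency matrix, row by row, and everything else is `0`. -/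
def inputState {n : ℕ} (E : Finset (Fin n × Fin n)) : State where
  reg x := if x = 0 then n else 0
  arr a k := if a = 0 ∧ ∃ e ∈ E, k = (e.1 : ℕ) * n + (e.2 : ℕ) then 1 else 0

/-- The output convention: the first `n` cells of array `1` list the permutation `π`. -/
def Outputs {n : ℕ} (s : State) (π : Fin n ≃ Fin n) : Prop :=
  ∀ i : Fin n, s.arr 1 (i : ℕ) = (π i : ℕ)

/-- In polynomial time one can compute, for every bipartite graph with `n` vertices on each side that
has a perfect matching, a permutation `π` of `V` such that, for every arrival order `σ` of `U`, the
greedy matching has at least `r * n` edges: a single program does so for all `n` and all graphs, in a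
number of steps bounded by a polynomial in `n`. -/
def ComputableInPolyTime (r : ℝ) : Prop :=
  ∃ (c : Prog) (p : Polynomial ℕ), ∀ (n : ℕ) (E : Finset (Fin n × Fin n)), HasPerfectMatching E →
    ∃ (t : ℕ) (s : State) (π : Fin n ≃ Fin n),
      Exec c (inputState E) t s ∧ t ≤ p.eval n ∧ Outputs s π ∧
        ∀ σ : Fin n ≃ Fin n, r * (n : ℝ) ≤ ((greedyMatching E σ π).card : ℝ)

end MaxMinGreedy

/-!
Fix a perfect matching of the graph and rename each vertex of `U` to its partner, so that both sides
have the same vertex set. Let `W` be the set of unmatched vertices of `V` after a greedy run, and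
`P` the set of matched vertices of `U`. If `j ∈ W`, then each neighbor of `j` is matched to a vertex
below `j`. In particular `W ⊆ P`, and the number of matched vertices exceeds that of unmatched ones
by `|P \ W|` (`Outcome.card_sdiff_add`). It has to be shown that `|P \ W| ≥ n / 43` for a suitable
order. Delete the perfect matching, let `f` be a maximum matching of the remaining graph, and let
`k` be the number of vertices of `V` that `f` misses.

* The deficiency version of Hall's theorem yields sets `Y` and `Z`, of sizes `|Y| = |Z| + k`, such
  that `Z` contains all neighbors of `Y` in the remaining graph. If the order starts with `Z ∩ Y`
  and continues with `Y \ Z`, then `|P \ W| ≥ k` (`Outcome.deficiency_le`). This settles the case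
  `43 * k ≥ n`.
* If `43 * k < n`, regard `f` as a partial injection of the vertex set into itself. Its graph
  consists of paths and cycles, on which a maximal independent set `F` is chosen. An unmatched vertex
  of an initial segment `F` of the order has two private neighbors that are matched into `F`, so that
  about two thirds of `F` at least are matched. Moreover an unmatched vertex is preceded on its path
  by an unmatched one, except where a vertex of `P \ W` is spent. Hence each unmatched vertex of `F`
  accounts for two unmatched vertices, or for three if the next vertex of `F` is three steps away;
  the vertices of the latter kind form a set `F₃`, which is put first, so that at most about a third
  of it is unmatched as well. Altogether only about a third of all vertices is unmatched, up to
  multiples of `k` and `|P \ W|` (`Outcome.card_le_of_independent`).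

Both orders depend only on a partition of `V` into three classes, listed one after the other. The
algorithm computes the two matchings by an auction, whose prices also provide the sets `Y` and `Z`:
since fewer than `n` objects are sold when a buyer is left over, one of the prices `1, …, n` is not
taken, and the objects above such a gap are exactly what the buyers above it compete for
(`AuctionInv.lt_price`, `AuctionInv.card_buyers_eq`). The program is written in a sublanguage whose
loops all run from `1` to `n`; this gives termination and a polynomial time bound from the syntax
alone (`ForProg.exists_exec`), and leaves only its effect on the memory to be analyzed. The statements
about arbitrary graphs follow from the correctness of the algorithm by renaming vertices.
-/

namespace MaxMinGreedy

/-! ### Bounded loops on the random access machine -/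

/-- The state `s` with register `x` set to `k`. -/
def State.setReg (s : State) (x k : ℕ) : State :=
  { s with reg := Function.update s.reg x k }

/-- The state `s` with cell `i` of array `a` set to `k`. -/
def State.setArr (s : State) (a i k : ℕ) : State :=
  { s with arr := Function.update s.arr a (Function.update (s.arr a) i k) }

@[simp] theorem State.setReg_reg (s : State) (x k y : ℕ) :
    (s.setReg x k).reg y = if y = x then k else s.reg y := by
  simp [State.setReg, Function.update_apply]

@[simp] theorem State.setReg_arr (s : State) (x k : ℕ) : (s.setReg x k).arr = s.arr := rfl

@[simp] theorem State.setArr_reg (s : State) (a i k : ℕ) : (s.setArr a i k).reg = s.reg := rfl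

@[simp] theorem State.setArr_arr (s : State) (a i k b : ℕ) :
    (s.setArr a i k).arr b = if b = a then Function.update (s.arr a) i k else s.arr b := by
  simp only [State.setArr, Function.update_apply]

/-- Programs whose only loops run a register through `1, …, n`, where `n` is the content of
register `0`. Such programs always halt, and their running time is bounded by a polynomial in `n`
that is read off from the text of the program. -/
inductive ForProg where
  /-- do nothing -/
  | skip
  /-- write the value of `e` into register `x` -/
  | assign (x : ℕ) (e : Exp)
  /-- write the value of `e` into the cell of array `a` whose index is the value of `i` -/
  | store (a : ℕ) (i e : Exp)
  /-- first `c₁`, then `c₂` -/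
  | seq (c₁ c₂ : ForProg)
  /-- `c₁` if the condition `b` holds, else `c₂` -/
  | ite (b : Exp) (c₁ c₂ : ForProg)
  /-- execute `c` with register `x` equal to `1, …, n` in turn -/
  | forTo (x : ℕ) (c : ForProg)

namespace ForProg

/-- The state in which a program with loop bound `n` halts. -/
def sem (n : ℕ) : ForProg → State → State
  | skip, s => s
  | assign x e, s => s.setReg x (e.eval s)
  | store a i e, s => s.setArr a (i.eval s) (e.eval s)
  | seq c₁ c₂, s => c₂.sem n (c₁.sem n s)
  | ite b c₁ c₂, s => if b.eval s ≠ 0 then c₁.sem n s else c₂.sem n s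
  | forTo x c, s =>
      (List.range n).foldl (fun s i => c.sem n (s.setReg x (i + 1))) (s.setReg x 0)

/-- Translation into the language of the machine. -/
def toProg : ForProg → Prog
  | skip => .skip
  | assign x e => .assign x e
  | store a i e => .store a i e
  | seq c₁ c₂ => .seq c₁.toProg c₂.toProg
  | ite b c₁ c₂ => .cond b c₁.toProg c₂.toProg
  | forTo x c => .seq (.assign x (.lit 0))
      (.loop (.sub (.reg 0) (.reg x)) (.seq (.assign x (.add (.reg x) (.lit 1))) c.toProg))

/-- The program does not write into register `x`. -/
def keepsReg (x : ℕ) : ForProg → Bool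
  | skip => true
  | assign y _ => y != x
  | store _ _ _ => true
  | seq c₁ c₂ => c₁.keepsReg x && c₂.keepsReg x
  | ite _ c₁ c₂ => c₁.keepsReg x && c₂.keepsReg x
  | forTo y c => y != x && c.keepsReg x

/-- The program does not write into array `a`. -/
def keepsArr (a : ℕ) : ForProg → Bool
  | skip => true
  | assign _ _ => true
  | store b _ _ => b != a
  | seq c₁ c₂ => c₁.keepsArr a && c₂.keepsArr a
  | ite _ c₁ c₂ => c₁.keepsArr a && c₂.keepsArr a
  | forTo _ c => c.keepsArr a

/-- No loop writes into its own counter. -/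
def safe : ForProg → Bool
  | skip => true
  | assign _ _ => true
  | store _ _ _ => true
  | seq c₁ c₂ => c₁.safe && c₂.safe
  | ite _ c₁ c₂ => c₁.safe && c₂.safe
  | forTo x c => c.keepsReg x && c.safe

/-- A polynomial bound on the number of steps. -/
noncomputable def time : ForProg → Polynomial ℕ
  | skip => 1
  | assign _ e => Polynomial.C (e.cost + 1)
  | store _ i e => Polynomial.C (i.cost + e.cost + 1)
  | seq c₁ c₂ => c₁.time + c₂.time
  | ite b c₁ c₂ => Polynomial.C (b.cost + 1) + c₁.time + c₂.time
  | forTo _ c => Polynomial.C 6 + Polynomial.X * (Polynomial.C 8 + c.time)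

/-- The invariant rule for bounded loops: `I i` holds after `i` rounds. -/
theorem sem_forTo_induct {n x : ℕ} {c : ForProg} {s : State} (I : ℕ → State → Prop)
    (h0 : I 0 (s.setReg x 0))
    (hstep : ∀ i < n, ∀ s, I i s → I (i + 1) (c.sem n (s.setReg x (i + 1)))) :
    I n ((forTo x c).sem n s) := by
  have key : ∀ k ≤ n, I k
      ((List.range k).foldl (fun s i => c.sem n (s.setReg x (i + 1))) (s.setReg x 0)) := by
    intro k
    induction k with
    | zero => intro _; simpa using h0
    | succ k ih =>
      intro hk
      rw [List.range_succ, List.foldl_append]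
      exact hstep k (by omega) _ (ih (by omega))
  exact key n le_rfl

theorem sem_reg_eq {x : ℕ} (n : ℕ) : ∀ (c : ForProg) (s : State), c.keepsReg x = true →
    (c.sem n s).reg x = s.reg x
  | skip, s, _ => rfl
  | assign y e, s, h => by
      have : x ≠ y := by simpa [keepsReg, ne_comm] using h
      simp [sem, this]
  | store _ _ _, s, _ => by simp [sem]
  | seq c₁ c₂, s, h => by
      simp only [keepsReg, Bool.and_eq_true] at h
      simp only [sem]
      rw [sem_reg_eq n c₂ _ h.2, sem_reg_eq n c₁ _ h.1]
  | ite b c₁ c₂, s, h => by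
      simp only [keepsReg, Bool.and_eq_true] at h
      simp only [sem]
      split_ifs
      · exact sem_reg_eq n c₁ _ h.1
      · exact sem_reg_eq n c₂ _ h.2
  | forTo y c, s, h => by
      simp only [keepsReg, Bool.and_eq_true, bne_iff_ne] at h
      refine sem_forTo_induct (fun _ t => t.reg x = s.reg x) (by simp [h.1.symm]) ?_
      intro i _ t ht
      rw [sem_reg_eq n c _ h.2]
      simpa [h.1.symm] using ht

theorem sem_arr_eq {a : ℕ} (n : ℕ) : ∀ (c : ForProg) (s : State), c.keepsArr a = true →
    (c.sem n s).arr a = s.arr a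
  | skip, s, _ => rfl
  | assign y e, s, _ => rfl
  | store b _ _, s, h => by
      have : a ≠ b := by simpa [keepsArr, ne_comm] using h
      simp [sem, this]
  | seq c₁ c₂, s, h => by
      simp only [keepsArr, Bool.and_eq_true] at h
      simp only [sem]
      rw [sem_arr_eq n c₂ _ h.2, sem_arr_eq n c₁ _ h.1]
  | ite b c₁ c₂, s, h => by
      simp only [keepsArr, Bool.and_eq_true] at h
      simp only [sem]
      split_ifs
      · exact sem_arr_eq n c₁ _ h.1
      · exact sem_arr_eq n c₂ _ h.2
  | forTo y c, s, h => by
      refine sem_forTo_induct (fun _ t => t.arr a = s.arr a) rfl ?_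
      intro i _ t ht
      rw [sem_arr_eq n c _ h]
      exact ht

/-- A bounded program halts within its time bound in the state that `sem` predicts. -/
theorem exists_exec (n : ℕ) : ∀ (c : ForProg) (s : State), c.keepsReg 0 = true → c.safe = true →
    s.reg 0 = n → ∃ t, t ≤ c.time.eval n ∧ Exec c.toProg s t (c.sem n s)
  | skip, s, _, _, _ => ⟨1, by simp [time], Exec.skip s⟩
  | assign x e, s, _, _, _ => ⟨_, by simp [time], Exec.assign x e s⟩
  | store a i e, s, _, _, _ => ⟨_, by simp [time], Exec.store a i e s⟩
  | seq c₁ c₂, s, hk, hs, h0 => by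
      simp only [keepsReg, safe, Bool.and_eq_true] at hk hs
      obtain ⟨t₁, ht₁, he₁⟩ := exists_exec n c₁ s hk.1 hs.1 h0
      obtain ⟨t₂, ht₂, he₂⟩ := exists_exec n c₂ (c₁.sem n s) hk.2 hs.2
        (by rw [sem_reg_eq n c₁ s hk.1, h0])
      exact ⟨t₁ + t₂, by simp only [time, Polynomial.eval_add]; omega, Exec.seq he₁ he₂⟩
  | ite b c₁ c₂, s, hk, hs, h0 => by
      simp only [keepsReg, safe, Bool.and_eq_true] at hk hs
      by_cases hb : b.eval s = 0
      · obtain ⟨t, ht, he⟩ := exists_exec n c₂ s hk.2 hs.2 h0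
        refine ⟨b.cost + 1 + t, ?_, ?_⟩
        · simp only [time, Polynomial.eval_add, Polynomial.eval_C]; omega
        · simp only [sem, hb, ne_eq, not_true_eq_false, if_false]
          exact Exec.cond_false hb he
      · obtain ⟨t, ht, he⟩ := exists_exec n c₁ s hk.1 hs.1 h0
        refine ⟨b.cost + 1 + t, ?_, ?_⟩
        · simp only [time, Polynomial.eval_add, Polynomial.eval_C]; omega
        · simp only [sem, ne_eq, hb, not_false_eq_true, if_true]
          exact Exec.cond_true hb he
  | forTo x c, s, hk, hs, h0 => by
      simp only [keepsReg, safe, Bool.and_eq_true, bne_iff_ne] at hk hs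
      -- the loop, entered when the counter is `n - k`, runs for `k` more rounds
      have key : ∀ k ≤ n, ∀ s : State, s.reg 0 = n → s.reg x = n - k →
          ∃ t, t ≤ k * (8 + c.time.eval n) + 4 ∧
            Exec (.loop (.sub (.reg 0) (.reg x)) (.seq (.assign x (.add (.reg x) (.lit 1))) c.toProg))
              s t ((List.range' (n - k) k).foldl (fun s i => c.sem n (s.setReg x (i + 1))) s) := by
        intro k
        induction k with
        | zero =>
          intro _ s h0 hx
          exact ⟨_, by simp [Exp.cost], Exec.loop_false (by simp [Exp.eval, h0, hx])⟩
        | succ k ih =>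
          intro hkn s h0 hx
          obtain ⟨t₁, ht₁, he₁⟩ := exists_exec n c (s.setReg x (n - (k + 1) + 1)) hk.2 hs.2
            (by simp [hk.1.symm, h0])
          obtain ⟨t₂, ht₂, he₂⟩ := ih (by omega) (c.sem n (s.setReg x (n - (k + 1) + 1)))
            (by rw [sem_reg_eq n c _ hk.2]; simp [hk.1.symm, h0])
            (by rw [sem_reg_eq n c _ hs.1]; simp; omega)
          have ha : Exec (.assign x (.add (.reg x) (.lit 1))) s 4
              (s.setReg x (n - (k + 1) + 1)) := by
            have := Exec.assign x (.add (.reg x) (.lit 1)) s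
            simpa [Exp.eval, Exp.cost, hx, State.setReg] using this
          have hl := Exec.loop_true (b := .sub (.reg 0) (.reg x))
            (by simp only [Exp.eval, h0, hx]; omega) (Exec.seq ha he₁) he₂
          refine ⟨3 + 1 + (4 + t₁) + t₂, ?_, ?_⟩
          · have : (k + 1) * (8 + c.time.eval n) = k * (8 + c.time.eval n) + (8 + c.time.eval n) := by
              ring
            omega
          · rw [List.range'_succ, List.foldl_cons, show n - (k + 1) + 1 = n - k by omega]
            rw [show n - (k + 1) + 1 = n - k by omega] at hl
            exact hl
      obtain ⟨t, ht, he⟩ := key n le_rfl (s.setReg x 0) (by simp [hk.1.symm, h0]) (by simp)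
      refine ⟨2 + t, ?_, ?_⟩
      · simp only [time, Polynomial.eval_add, Polynomial.eval_mul, Polynomial.eval_C,
          Polynomial.eval_X]
        omega
      · simp only [sem, toProg, List.range_eq_range']
        rw [Nat.sub_self] at he
        exact Exec.seq (Exec.assign x (.lit 0) s) he

end ForProg

/-! ### Properties of a greedy matching -/

section GreedyFacts

variable {U V : Type*} [DecidableEq U] [DecidableEq V]

/-- What is used about a greedy matching `M`: it is a matching in `E`, and each neighbor `u` of an
unmatched vertex `v` is matched to a vertex below `v`. -/
structure IsGreedyOutcome {m : ℕ} (E : Finset (U × V)) (π : Fin m ≃ V) (M : Finset (U × V)) :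
    Prop where
  subset : M ⊆ E
  left_inj : ∀ u v v', (u, v) ∈ M → (u, v') ∈ M → v = v'
  right_inj : ∀ u u' v, (u, v) ∈ M → (u', v) ∈ M → u = u'
  lower : ∀ u v, (u, v) ∈ E → (∀ e ∈ M, e.2 ≠ v) → ∃ v', (u, v') ∈ M ∧ π.symm v' < π.symm v

/-- The properties of the partial matching after the vertices in `us` have arrived. -/
structure GreedyInv {m : ℕ} (E : Finset (U × V)) (π : Fin m ≃ V) (us : List U)
    (M : Finset (U × V)) : Prop where
  subset : M ⊆ E
  arrived : ∀ e ∈ M, e.1 ∈ us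
  left_inj : ∀ u v v', (u, v) ∈ M → (u, v') ∈ M → v = v'
  right_inj : ∀ u u' v, (u, v) ∈ M → (u', v) ∈ M → u = u'
  lower : ∀ u ∈ us, ∀ v, (u, v) ∈ E → (∀ e ∈ M, e.2 ≠ v) →
    ∃ v', (u, v') ∈ M ∧ π.symm v' < π.symm v

theorem GreedyInv.step {m : ℕ} {E : Finset (U × V)} {π : Fin m ≃ V} {us : List U}
    {M : Finset (U × V)} (h : GreedyInv E π us M) {u : U} (hu : u ∉ us) :
    GreedyInv E π (us ++ [u]) (greedyStep E π M u) := by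
  unfold greedyStep
  split
  · rename_i v hv
    rw [List.find?_eq_some_iff_getElem] at hv
    obtain ⟨hp, i, hi, hiv, hmin⟩ := hv
    simp only [decide_eq_true_eq] at hp
    simp only [List.length_ofFn] at hi
    simp only [List.getElem_ofFn] at hiv hmin
    refine ⟨?_, ?_, ?_, ?_, ?_⟩
    · exact Finset.insert_subset hp.1 h.subset
    · intro e he
      rcases Finset.mem_insert.1 he with rfl | he
      · simp
      · simp [h.arrived e he]
    · intro a v₁ v₂ h₁ h₂
      simp only [Finset.mem_insert, Prod.mk.injEq] at h₁ h₂
      have := h.left_inj a v₁ v₂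
      have := fun w hw => h.arrived (u, w) hw
      grind
    · intro a b v₁ h₁ h₂
      simp only [Finset.mem_insert, Prod.mk.injEq] at h₁ h₂
      have := h.right_inj a b v₁
      have := fun w hw => hp.2 (w, v) hw
      grind
    · intro a ha v₁ hav hfree
      have hfree' : ∀ e ∈ M, e.2 ≠ v₁ := fun e he => hfree e (Finset.mem_insert_of_mem he)
      rcases List.mem_append.1 ha with ha | ha
      · obtain ⟨v', hv', hlt⟩ := h.lower a ha v₁ hav hfree'
        exact ⟨v', Finset.mem_insert_of_mem hv', hlt⟩
      · obtain rfl : a = u := by simpa using ha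
        refine ⟨v, Finset.mem_insert_self _ _, ?_⟩
        have hne : v ≠ v₁ := hfree (a, v) (Finset.mem_insert_self _ _)
        have hsymm : π.symm v = ⟨i, hi⟩ := by rw [← hiv]; simp
        by_contra hlt
        have hlt' : (π.symm v₁ : ℕ) < i := by
          rcases lt_or_eq_of_le (not_lt.1 hlt) with h' | h'
          · rw [hsymm] at h'; exact h'
          · exact absurd (π.symm.injective h').symm hne
        have := hmin _ hlt'
        simp [hav] at this
        obtain ⟨b, hb⟩ := this
        exact hfree' _ hb rfl
  · rename_i hnone
    refine ⟨h.subset, ?_, h.left_inj, h.right_inj, ?_⟩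
    · intro e he
      simp [h.arrived e he]
    · intro a ha v₁ hav hfree
      rcases List.mem_append.1 ha with ha | ha
      · exact h.lower a ha v₁ hav hfree
      · obtain rfl : a = u := by simpa using ha
        rw [List.find?_eq_none] at hnone
        have := hnone v₁ (List.mem_ofFn.2 ⟨π.symm v₁, by simp⟩)
        simp only [decide_eq_true_eq, not_and] at this
        exact absurd hfree (this hav)

theorem isGreedyOutcome_greedyMatching {l m : ℕ} (E : Finset (U × V)) (σ : Fin l ≃ U)
    (π : Fin m ≃ V) : IsGreedyOutcome E π (greedyMatching E σ π) := by
  have key : ∀ (us vs : List U) (M : Finset (U × V)), (vs ++ us).Nodup → GreedyInv E π vs M →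
      GreedyInv E π (vs ++ us) (us.foldl (greedyStep E π) M) := by
    intro us
    induction us with
    | nil => intro vs M _ h; simpa using h
    | cons u us ih =>
      intro vs M hnd h
      have hu : u ∉ vs := by
        intro hmem
        exact (List.nodup_append.1 hnd).2.2 u hmem u (by simp) rfl
      have := ih (vs ++ [u]) _ (by simpa using hnd) (h.step hu)
      simpa using this
  have h := key (List.ofFn σ) [] ∅ (by simpa using List.nodup_ofFn.2 σ.injective)
    ⟨by simp, by simp, by simp, by simp, by simp⟩
  refine ⟨h.subset, h.left_inj, h.right_inj, fun u v huv hv => h.lower u ?_ v huv hv⟩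
  simp only [List.nil_append, List.mem_ofFn]
  exact ⟨σ.symm u, by simp⟩

end GreedyFacts

/-! ### The combinatorial core -/

/-- The outcome of a greedy matching, after each vertex of `U` has been renamed to its partner in a
fixed perfect matching, so that both sides have the vertex set `V`. Here `A i j` says that the
vertex `i` of the left side is adjacent to the vertex `j` of the right side, `W` is the set of
unmatched vertices of the right side, `P` is the set of matched vertices of the left side, `m` maps
the latter to their partners, and `key` is a priority which the order of the right side respects
(ties are broken in an unknown way). -/
structure Outcome (V W P : Finset ℕ) (A : ℕ → ℕ → Prop) (key m : ℕ → ℕ) : Prop where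
  refl : ∀ i ∈ V, A i i
  W_sub : W ⊆ V
  P_sub : P ⊆ V
  maps : ∀ i ∈ P, m i ∈ V \ W
  inj : Set.InjOn m P
  card : P.card + W.card = V.card
  adj : ∀ i ∈ P, A i (m i)
  lower : ∀ j ∈ W, ∀ i ∈ V, A i j → i ∈ P ∧ key (m i) ≤ key j

namespace Outcome

variable {V W P : Finset ℕ} {A : ℕ → ℕ → Prop} {key m : ℕ → ℕ}

theorem W_sub_P (h : Outcome V W P A key m) : W ⊆ P := fun j hj =>
  (h.lower j hj j (h.W_sub hj) (h.refl j (h.W_sub hj))).1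

theorem exists_partner (h : Outcome V W P A key m) {v : ℕ} (hv : v ∈ V) (hW : v ∉ W) :
    ∃ i ∈ P, m i = v := by
  have himg : P.image m = V \ W := by
    apply Finset.eq_of_subset_of_card_le
    · intro x hx
      obtain ⟨i, hi, rfl⟩ := Finset.mem_image.1 hx
      exact h.maps i hi
    · rw [Finset.card_image_of_injOn h.inj, Finset.card_sdiff_of_subset h.W_sub]
      have := h.card
      omega
  have : v ∈ P.image m := by rw [himg]; simp [hv, hW]
  simpa using this

/-- The excess of matched over unmatched vertices is the number of left vertices that are matched
although their partner in the perfect matching is matched too. -/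
theorem card_sdiff_add (h : Outcome V W P A key m) :
    (P \ W).card + 2 * W.card = V.card := by
  rw [Finset.card_sdiff_of_subset h.W_sub_P]
  have := Finset.card_le_card h.W_sub_P
  have := h.card
  omega

/-- If `Z` contains all neighbors of `Y` outside the perfect matching, and `Z ∩ Y` comes first and
`Y \ Z` next, then the excess is at least the deficiency `|Y| - |Z|`: all of `Y \ Z` gets matched,
and an unmatched vertex of `Z ∩ Y` has its left partner matched inside `Z ∩ Y`, so that only the
`|Z \ Y|` left partners of unmatched vertices in `Z \ Y` are available for `Y \ Z`. -/
theorem deficiency_le (h : Outcome V W P A key m) {Y Z : Finset ℕ} (hY : Y ⊆ V)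
    (hZ : ∀ y ∈ Y, ∀ i ∈ V, A i y → i ≠ y → i ∈ Z)
    (hkey0 : ∀ v ∈ V, key v = 0 ↔ v ∈ Y ∧ v ∈ Z) (hkey1 : ∀ v ∈ V, key v ≤ 1 ↔ v ∈ Y) :
    Y.card ≤ Z.card + (P \ W).card := by
  have hYZ : ∀ y ∈ Y \ Z, y ∉ W := by
    intro y hy hyW
    obtain ⟨hyY, hyZ⟩ := Finset.mem_sdiff.1 hy
    have hyV := hY hyY
    obtain ⟨hP, hk⟩ := h.lower y hyW y hyV (h.refl y hyV)
    have hm := Finset.mem_sdiff.1 (h.maps y hP)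
    have hmY : m y ∈ Y := (hkey1 _ hm.1).1 (hk.trans ((hkey1 y hyV).2 hyY))
    exact hyZ (hZ _ hmY y hyV (h.adj y hP) (fun he => hm.2 (he ▸ hyW)))
  have hsub : Y \ Z ⊆ (Z \ Y ∪ P \ W).image m := by
    intro y hy
    obtain ⟨hyY, hyZ⟩ := Finset.mem_sdiff.1 hy
    obtain ⟨i, hiP, rfl⟩ := h.exists_partner (hY hyY) (hYZ y hy)
    refine Finset.mem_image_of_mem m ?_
    by_cases hiW : i ∈ W
    · have hiV := h.W_sub hiW
      have hne : i ≠ m i := fun he => hYZ _ hy (he ▸ hiW)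
      have hiZ := hZ _ hyY i hiV (h.adj i hiP) hne
      refine Finset.mem_union_left _ (Finset.mem_sdiff.2 ⟨hiZ, fun hiY => ?_⟩)
      have hk := (h.lower i hiW i hiV (h.refl i hiV)).2
      rw [(hkey0 i hiV).2 ⟨hiY, hiZ⟩] at hk
      exact hyZ ((hkey0 _ (hY hyY)).1 (by omega)).2
    · exact Finset.mem_union_right _ (Finset.mem_sdiff.2 ⟨hiP, hiW⟩)
  have h1 := Finset.card_le_card hsub
  have h2 := (Finset.card_image_le (s := Z \ Y ∪ P \ W) (f := m))
  have h3 := Finset.card_union_le (Z \ Y) (P \ W)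
  have h4 := Finset.card_sdiff_add_card_inter Y Z
  have h5 := Finset.card_sdiff_add_card_inter Z Y
  rw [Finset.inter_comm] at h5
  omega

variable {Q : Finset ℕ} {f : ℕ → ℕ}

/-- Suppose that `f` assigns to the vertices of `Q` distinct second neighbors, and that `F` comes
first in the order and contains no pair `v`, `f v`. Then about a third of `F` at most is unmatched,
since an unmatched vertex of `F ∩ Q` has two private neighbors, both matched into `F`. -/
theorem three_mul_card_inter_le (h : Outcome V W P A key m)
    (hfV : ∀ q ∈ Q, f q ∈ V) (hfA : ∀ q ∈ Q, A (f q) q) (hfinj : Set.InjOn f Q)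
    {F : Finset ℕ} (hF : F ⊆ V) {c : ℕ} (hkey : ∀ v ∈ V, key v ≤ c ↔ v ∈ F)
    (hind : ∀ q ∈ Q, q ∈ F → f q ∉ F) :
    3 * (W ∩ F).card ≤ F.card + (V \ Q).card := by
  have hdisj : Disjoint (W ∩ F) ((W ∩ F ∩ Q).image f) := by
    rw [Finset.disjoint_left]
    intro x hx hx'
    obtain ⟨q, hq, rfl⟩ := Finset.mem_image.1 hx'
    simp only [Finset.mem_inter] at hq hx
    exact hind q hq.2 hq.1.2 hx.2
  have hsub : ((W ∩ F) ∪ (W ∩ F ∩ Q).image f).image m ⊆ F \ W := by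
    intro y hy
    obtain ⟨i, hi, rfl⟩ := Finset.mem_image.1 hy
    have hex : ∃ j ∈ W ∩ F, i ∈ V ∧ A i j := by
      rcases Finset.mem_union.1 hi with hi | hi
      · have hiV := h.W_sub (Finset.mem_inter.1 hi).1
        exact ⟨i, hi, hiV, h.refl i hiV⟩
      · obtain ⟨q, hq, rfl⟩ := Finset.mem_image.1 hi
        obtain ⟨hq, hqQ⟩ := Finset.mem_inter.1 hq
        exact ⟨q, hq, hfV q hqQ, hfA q hqQ⟩
    obtain ⟨j, hj, hiV, hij⟩ := hex
    obtain ⟨hjW, hjF⟩ := Finset.mem_inter.1 hj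
    obtain ⟨hiP, hk⟩ := h.lower j hjW i hiV hij
    have hm := Finset.mem_sdiff.1 (h.maps i hiP)
    exact Finset.mem_sdiff.2
      ⟨(hkey _ hm.1).1 (hk.trans ((hkey j (h.W_sub hjW)).2 hjF)), hm.2⟩
  have hP : ((W ∩ F) ∪ (W ∩ F ∩ Q).image f) ⊆ P := by
    intro i hi
    rcases Finset.mem_union.1 hi with hi | hi
    · exact h.W_sub_P (Finset.mem_inter.1 hi).1
    · obtain ⟨q, hq, rfl⟩ := Finset.mem_image.1 hi
      simp only [Finset.mem_inter] at hq
      exact (h.lower q hq.1.1 _ (hfV q hq.2) (hfA q hq.2)).1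
  have h1 := Finset.card_le_card hsub
  rw [Finset.card_image_of_injOn (h.inj.mono (by exact_mod_cast hP)),
    Finset.card_union_of_disjoint hdisj,
    Finset.card_image_of_injOn (hfinj.mono (by intro x hx; simp at hx; exact hx.2.2))] at h1
  have h2 := Finset.card_sdiff_add_card_inter (W ∩ F) Q
  have h3 := Finset.card_sdiff_add_card_inter F W
  rw [Finset.inter_comm] at h3
  have h4 : (W ∩ F) \ Q ⊆ V \ Q := fun x hx => by
    simp only [Finset.mem_sdiff, Finset.mem_inter] at hx ⊢
    exact ⟨hF hx.1.2, hx.2⟩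
  have h5 := Finset.card_le_card h4
  omega

/-- The number of vertices that are matched although an `f`-preimage of them is unmatched is at most
the excess. -/
theorem card_boundary_le (h : Outcome V W P A key m)
    (hfV : ∀ q ∈ Q, f q ∈ V) (hfA : ∀ q ∈ Q, A (f q) q) (hfinj : Set.InjOn f Q) :
    ((W ∩ Q).filter (fun w => f w ∉ W)).card ≤ (P \ W).card := by
  rw [← Finset.card_image_of_injOn (f := f) (hfinj.mono (by intro x hx; simp at hx; exact hx.1.2))]
  refine Finset.card_le_card ?_
  intro y hy
  obtain ⟨w, hw, rfl⟩ := Finset.mem_image.1 hy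
  simp only [Finset.mem_filter, Finset.mem_inter] at hw
  exact Finset.mem_sdiff.2 ⟨(h.lower w hw.1.1 _ (hfV w hw.1.2) (hfA w hw.1.2)).1, hw.2⟩

/-- Walking along `f` from any vertex, a vertex of the maximal independent set `F` is reached after
at most two steps (or `f` becomes undefined). So every unmatched vertex is charged to an unmatched
vertex of `F`, or to a change from unmatched to matched along the walk. Only the vertices of `F₃`
are reached from two steps away. -/
theorem card_unmatched_le (h : Outcome V W P A key m)
    (hfV : ∀ q ∈ Q, f q ∈ V) (hfA : ∀ q ∈ Q, A (f q) q) (hfinj : Set.InjOn f Q)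
    {F F₃ : Finset ℕ}
    (hmax : ∀ v ∈ V, v ∉ F → (v ∈ Q ∧ f v ∈ F) ∨ ∃ q ∈ Q, q ∈ F ∧ f q = v)
    (hF₃ : ∀ q ∈ Q, f q ∈ Q → f (f q) ∈ F → q ∉ F → f (f q) ∈ F₃) :
    W.card ≤ 2 * (W ∩ F).card + (W ∩ F₃).card + 2 * (P \ W).card + (V \ Q).card := by
  set Λ := (W ∩ Q).filter (fun w => f w ∉ W) with hΛ
  have hΛc : Λ.card ≤ (P \ W).card := h.card_boundary_le hfV hfA hfinj
  have hpre : ∀ s : Finset ℕ, ((W ∩ Q).filter (fun w => f w ∈ s)).card ≤ s.card := by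
    intro s
    refine Finset.card_le_card_of_injOn f (fun w hw => (Finset.mem_filter.1 hw).2) ?_
    exact hfinj.mono (by intro x hx; simp at hx; exact hx.1.2)
  have hpre2 : ((W ∩ Q).filter (fun w => f w ∈ Q ∧ f (f w) ∈ W ∩ F₃)).card ≤ (W ∩ F₃).card := by
    refine Finset.card_le_card_of_injOn (fun w => f (f w))
      (fun w hw => (Finset.mem_filter.1 hw).2.2) ?_
    intro x hx y hy hxy
    simp only [Finset.coe_filter, Finset.mem_inter, Set.mem_ofPred_eq] at hx hy
    exact hfinj hx.1.2 hy.1.2 (hfinj hx.2.1 hy.2.1 hxy)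
  have hsub : W ⊆ (W ∩ F) ∪ ((W ∩ Q).filter (fun w => f w ∈ W ∩ F)) ∪
      ((W ∩ Q).filter (fun w => f w ∈ Q ∧ f (f w) ∈ W ∩ F₃)) ∪ Λ ∪
      ((W ∩ Q).filter (fun w => f w ∈ Λ)) ∪ (V \ Q) := by
    intro w hw
    have hwV := h.W_sub hw
    simp only [Finset.mem_union, Finset.mem_inter, Finset.mem_filter, Finset.mem_sdiff]
    by_cases hwQ : w ∈ Q
    swap
    · exact Or.inr ⟨hwV, hwQ⟩
    by_cases hwF : w ∈ F
    · tauto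
    by_cases hfW : f w ∈ W
    swap
    · exact Or.inl (Or.inl (Or.inr (Finset.mem_filter.2 ⟨Finset.mem_inter.2 ⟨hw, hwQ⟩, hfW⟩)))
    by_cases hfF : f w ∈ F
    · tauto
    rcases hmax (f w) (hfV w hwQ) hfF with ⟨hfQ, hffF⟩ | ⟨q, hq, hqF, hqw⟩
    · by_cases hffW : f (f w) ∈ W
      · have := hF₃ w hwQ hfQ hffF hwF
        tauto
      · exact Or.inl (Or.inr ⟨⟨hw, hwQ⟩,
          Finset.mem_filter.2 ⟨Finset.mem_inter.2 ⟨hfW, hfQ⟩, hffW⟩⟩)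
    · exact absurd (hfinj hq hwQ hqw ▸ hqF) hwF
  have hc := Finset.card_le_card hsub
  have u1 := Finset.card_union_le ((W ∩ F) ∪ ((W ∩ Q).filter (fun w => f w ∈ W ∩ F)) ∪
      ((W ∩ Q).filter (fun w => f w ∈ Q ∧ f (f w) ∈ W ∩ F₃)) ∪ Λ ∪
      ((W ∩ Q).filter (fun w => f w ∈ Λ))) (V \ Q)
  have u2 := Finset.card_union_le ((W ∩ F) ∪ ((W ∩ Q).filter (fun w => f w ∈ W ∩ F)) ∪
      ((W ∩ Q).filter (fun w => f w ∈ Q ∧ f (f w) ∈ W ∩ F₃)) ∪ Λ)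
      ((W ∩ Q).filter (fun w => f w ∈ Λ))
  have u3 := Finset.card_union_le ((W ∩ F) ∪ ((W ∩ Q).filter (fun w => f w ∈ W ∩ F)) ∪
      ((W ∩ Q).filter (fun w => f w ∈ Q ∧ f (f w) ∈ W ∩ F₃))) Λ
  have u4 := Finset.card_union_le ((W ∩ F) ∪ ((W ∩ Q).filter (fun w => f w ∈ W ∩ F)))
      ((W ∩ Q).filter (fun w => f w ∈ Q ∧ f (f w) ∈ W ∩ F₃))
  have u5 := Finset.card_union_le (W ∩ F) ((W ∩ Q).filter (fun w => f w ∈ W ∩ F))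
  have := hpre (W ∩ F)
  have := hpre Λ
  omega

/-- The walks along `f` into different vertices of `F` are disjoint, have two vertices each, and
three if they end in `F₃`, unless they are cut off by one of the few vertices without an
`f`-preimage. -/
theorem two_mul_card_add_le (hQ : Q ⊆ V) (hfV : ∀ q ∈ Q, f q ∈ V)
    (hfinj : Set.InjOn f Q) {F F₃ : Finset ℕ} (hF : F ⊆ V) (hF₃F : F₃ ⊆ F)
    (hind : ∀ q ∈ Q, q ∈ F → f q ∉ F)
    (hF₃ : ∀ q ∈ Q, f q ∈ Q → f (f q) ∈ F₃ → q ∉ F) :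
    2 * F.card + F₃.card ≤ V.card + 3 * (V \ Q).card := by
  set R := V \ Q.image f with hR
  have hRc : R.card = (V \ Q).card := by
    rw [hR, Finset.card_sdiff_of_subset, Finset.card_sdiff_of_subset hQ,
      Finset.card_image_of_injOn hfinj]
    intro x hx
    obtain ⟨q, hq, rfl⟩ := Finset.mem_image.1 hx
    exact hfV q hq
  have hpre : ∀ s ⊆ V, s.card ≤ (Q.filter (fun q => f q ∈ s)).card + (V \ Q).card := by
    intro s hs
    have hsub : s ⊆ (Q.filter (fun q => f q ∈ s)).image f ∪ R := by
      intro x hx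
      by_cases hx' : x ∈ Q.image f
      · obtain ⟨q, hq, rfl⟩ := Finset.mem_image.1 hx'
        exact Finset.mem_union_left _
          (Finset.mem_image_of_mem f (Finset.mem_filter.2 ⟨hq, hx⟩))
      · exact Finset.mem_union_right _ (Finset.mem_sdiff.2 ⟨hs hx, hx'⟩)
    have h1 := Finset.card_le_card hsub
    have h2 := Finset.card_union_le ((Q.filter (fun q => f q ∈ s)).image f) R
    have h3 := Finset.card_image_le (s := Q.filter (fun q => f q ∈ s)) (f := f)
    omega
  set G := Q.filter (fun q => f q ∈ F) with hG
  set G₁ := Q.filter (fun q => f q ∈ F₃) with hG₁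
  set G₂ := Q.filter (fun q => f q ∈ G₁) with hG₂
  have hGV : G₁ ⊆ V := (Finset.filter_subset _ _).trans hQ
  have c1 := hpre F hF
  have c2 := hpre F₃ (hF₃F.trans hF)
  have c3 := hpre G₁ hGV
  have d1 : Disjoint F G := by
    rw [Finset.disjoint_left]
    intro x hx hx'
    rw [hG, Finset.mem_filter] at hx'
    exact hind x hx'.1 hx hx'.2
  have d2 : Disjoint (F ∪ G) G₂ := by
    rw [Finset.disjoint_left]
    intro x hx hx'
    simp only [hG₂, hG₁, hG, Finset.mem_filter, Finset.mem_union] at hx hx'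
    obtain ⟨hxQ, hfxQ, hffx⟩ := hx'
    rcases hx with hx | ⟨_, hx⟩
    · exact hF₃ x hxQ hfxQ hffx hx
    · exact hind (f x) hfxQ hx (hF₃F hffx)
  have hsub : F ∪ G ∪ G₂ ⊆ V :=
    Finset.union_subset (Finset.union_subset hF ((Finset.filter_subset _ _).trans hQ))
      ((Finset.filter_subset _ _).trans hQ)
  have hc := Finset.card_le_card hsub
  rw [Finset.card_union_of_disjoint d2, Finset.card_union_of_disjoint d1] at hc
  rw [← hG] at c1
  rw [← hG₁] at c2
  rw [← hG₂] at c3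
  omega

/-- If `f` is defined on more than a `42/43` fraction of the vertices, then the order that starts
with `F₃` and continues with the rest of `F` has an excess of at least `|V| / 43`. -/
theorem card_le_of_independent (h : Outcome V W P A key m) (hQ : Q ⊆ V)
    (hfV : ∀ q ∈ Q, f q ∈ V) (hfA : ∀ q ∈ Q, A (f q) q) (hfinj : Set.InjOn f Q)
    {F F₃ : Finset ℕ} (hF : F ⊆ V) (hF₃F : F₃ ⊆ F)
    (hind : ∀ q ∈ Q, q ∈ F → f q ∉ F)
    (hmax : ∀ v ∈ V, v ∉ F → (v ∈ Q ∧ f v ∈ F) ∨ ∃ q ∈ Q, q ∈ F ∧ f q = v)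
    (hF₃ : ∀ q ∈ Q, f q ∈ Q → f (f q) ∈ F → (f (f q) ∈ F₃ ↔ q ∉ F))
    (hkey0 : ∀ v ∈ V, key v ≤ 0 ↔ v ∈ F₃) (hkey1 : ∀ v ∈ V, key v ≤ 1 ↔ v ∈ F)
    (hcard : 43 * (V \ Q).card < V.card) :
    V.card ≤ 43 * (P \ W).card := by
  have h1 := h.card_sdiff_add
  have h2 := h.card_unmatched_le hfV hfA hfinj hmax
    (fun q hq hfq hF hqF => (hF₃ q hq hfq hF).2 hqF)
  have h3 := h.three_mul_card_inter_le hfV hfA hfinj hF hkey1 hind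
  have h4 := h.three_mul_card_inter_le hfV hfA hfinj (hF₃F.trans hF) hkey0
    (fun q hq hqF hfq => hind q hq (hF₃F hqF) (hF₃F hfq))
  have h5 := two_mul_card_add_le hQ hfV hfinj hF hF₃F hind
    (fun q hq hfq hF => (hF₃ q hq hfq (hF₃F hF)).1 hF)
  omega

end Outcome

/-! ### Bipartite matching by an auction -/

/-- The invariant of the auction on the bipartite graph `adj` between `{1, …, n}` (buyers `v`) and
`{1, …, n}` (objects `u`): `A v` is the object that `v` holds and `O u` the owner of `u`, with value
`0` if there is none, and `P u` is the price of `u`. Each buyer holds an object whose price is at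
most one above the cheapest price of its neighbors, and only objects with an owner have a price
above `0`. -/
structure AuctionInv (n : ℕ) (adj : ℕ → ℕ → Prop) (A O P : ℕ → ℕ) : Prop where
  A_zero : A 0 = 0
  O_zero : O 0 = 0
  A_le : ∀ v, A v ≤ n
  O_le : ∀ u, O u ≤ n
  O_A : ∀ v, A v ≠ 0 → O (A v) = v
  A_O : ∀ u, O u ≠ 0 → A (O u) = u
  adj_A : ∀ v, A v ≠ 0 → adj (A v) v
  slack : ∀ v, A v ≠ 0 → ∀ u, 1 ≤ u → u ≤ n → adj u v → P (A v) ≤ P u + 1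
  P_free : ∀ u, O u = 0 → P u = 0
  P_le : ∀ u, P u ≤ n + 1

/-- The auction is over: all neighbors of a buyer without an object have reached the price cap. -/
def AuctionOver (n : ℕ) (adj : ℕ → ℕ → Prop) (A P : ℕ → ℕ) : Prop :=
  ∀ v, 1 ≤ v → v ≤ n → A v = 0 → ∀ u, 1 ≤ u → u ≤ n → adj u v → n + 1 ≤ P u

/-- The buyer `v` bids for the object `u`. -/
theorem AuctionInv.bid {n : ℕ} {adj : ℕ → ℕ → Prop} {A O P : ℕ → ℕ}
    (h : AuctionInv n adj A O P) {u v : ℕ} (hv : 1 ≤ v) (hvn : v ≤ n) (hA : A v = 0)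
    (hu : 1 ≤ u) (hun : u ≤ n) (huv : adj u v) (hP : P u ≤ n)
    (hmin : ∀ u', 1 ≤ u' → u' ≤ n → adj u' v → P u ≤ P u') :
    AuctionInv n adj (Function.update (Function.update A (O u) 0) v u) (Function.update O u v)
      (Function.update P u (P u + 1)) := by
  have hA' : ∀ x, Function.update (Function.update A (O u) 0) v u x =
      if x = v then u else if x = O u then 0 else A x := by
    intro x; simp only [Function.update_apply]
  have hO' : ∀ x, Function.update O u v x = if x = u then v else O x := by
    intro x; simp only [Function.update_apply]
  have hP' : ∀ x, Function.update P u (P u + 1) x = if x = u then P u + 1 else P x := by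
    intro x; simp only [Function.update_apply]
  -- a buyer other than `v` that still holds something holds what it held before, and that is not `u`
  have hold : ∀ x, x ≠ v → Function.update (Function.update A (O u) 0) v u x ≠ 0 →
      Function.update (Function.update A (O u) 0) v u x = A x ∧ A x ≠ 0 ∧ A x ≠ u := by
    intro x hx h0
    rw [hA', if_neg hx] at h0 ⊢
    split_ifs at h0 ⊢ with h1
    · exact absurd rfl h0
    · exact ⟨rfl, h0, fun he => h1 (by rw [← he, h.O_A x h0])⟩
  have hAO : ∀ x, x ≠ u → O x ≠ 0 →
      Function.update (Function.update A (O u) 0) v u (O x) = x := by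
    intro x hx h0
    have h1 := h.A_O x h0
    have h2 : O x ≠ v := fun he => by
      rw [he, hA] at h1
      exact h0 (h1 ▸ h.O_zero)
    have h3 : O x ≠ O u := fun he => hx (by rw [← h1, he, h.A_O u (he ▸ h0)])
    rw [hA', if_neg h2, if_neg h3, h1]
  constructor
  · rw [hA', if_neg (by omega)]
    split_ifs
    · rfl
    · exact h.A_zero
  · rw [hO', if_neg (by omega), h.O_zero]
  · intro x
    rw [hA']
    split_ifs
    · exact hun
    · omega
    · exact h.A_le x
  · intro x
    rw [hO']
    split_ifs
    · exact hvn
    · exact h.O_le x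
  · intro x h0
    by_cases hx : x = v
    · rw [hA', if_pos hx, hO', if_pos rfl, hx]
    · obtain ⟨h1, h2, h3⟩ := hold x hx h0
      rw [h1, hO', if_neg h3, h.O_A x h2]
  · intro x h0
    rw [hO'] at h0 ⊢
    split_ifs at h0 ⊢ with hx
    · rw [hA', if_pos rfl, hx]
    · exact hAO x hx h0
  · intro x h0
    by_cases hx : x = v
    · rw [hA', if_pos hx, hx]
      exact huv
    · obtain ⟨h1, h2, h3⟩ := hold x hx h0
      rw [h1]
      exact h.adj_A x h2
  · intro x h0 y hy hyn hxy
    have hPy : P y ≤ Function.update P u (P u + 1) y := by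
      rw [hP']
      split_ifs with hyu
      · rw [hyu]; omega
      · exact le_rfl
    by_cases hx : x = v
    · rw [hA', if_pos hx, hP', if_pos rfl]
      have := hmin y hy hyn (hx ▸ hxy)
      omega
    · obtain ⟨h1, h2, h3⟩ := hold x hx h0
      rw [h1, hP', if_neg h3]
      have := h.slack x h2 y hy hyn hxy
      omega
  · intro x h0
    rw [hO'] at h0
    split_ifs at h0 with hx
    · omega
    · rw [hP', if_neg hx, h.P_free x h0]
  · intro x
    rw [hP']
    split_ifs
    · omega
    · exact h.P_le x

namespace AuctionInv

variable {n : ℕ} {adj : ℕ → ℕ → Prop} {A O P : ℕ → ℕ}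

theorem sum_price_le (h : AuctionInv n adj A O P) : ∑ u ∈ Finset.Icc 1 n, P u ≤ n * (n + 1) := by
  have := Finset.sum_le_card_nsmul (Finset.Icc 1 n) P (n + 1) (fun u _ => h.P_le u)
  simpa using this

/-- If no object has price `t`, then the buyers that hold nothing or something more expensive than
`t` have all their neighbors among the objects more expensive than `t`. -/
theorem lt_price (h : AuctionInv n adj A O P) (hover : AuctionOver n adj A P) {t : ℕ}
    (htn : t ≤ n) (hgap : ∀ u, 1 ≤ u → u ≤ n → P u ≠ t) {u v : ℕ} (hv : 1 ≤ v) (hvn : v ≤ n)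
    (hu : 1 ≤ u) (hun : u ≤ n) (hA : A v = 0 ∨ t < P (A v)) (huv : adj u v) : t < P u := by
  by_cases h0 : A v = 0
  · have := hover v hv hvn h0 u hu hun huv
    omega
  · have h1 := h.slack v h0 u hu hun huv
    have h2 := hgap u hu hun
    have h3 := hA.resolve_left h0
    omega

theorem card_buyers_eq (h : AuctionInv n adj A O P) (t : ℕ) :
    ((Finset.Icc 1 n).filter (fun v => A v = 0 ∨ t < P (A v))).card =
      ((Finset.Icc 1 n).filter (fun u => t < P u)).card +
        ((Finset.Icc 1 n).filter (fun v => A v = 0)).card := by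
  have hdisj : Disjoint ((Finset.Icc 1 n).filter (fun v => A v ≠ 0 ∧ t < P (A v)))
      ((Finset.Icc 1 n).filter (fun v => A v = 0)) := by
    rw [Finset.disjoint_filter]
    intro x _ hx
    exact hx.1
  have heq : ((Finset.Icc 1 n).filter (fun v => A v ≠ 0 ∧ t < P (A v))).card =
      ((Finset.Icc 1 n).filter (fun u => t < P u)).card := by
    refine Finset.card_bij (fun v _ => A v) ?_ ?_ ?_
    · intro v hv
      simp only [Finset.mem_filter, Finset.mem_Icc] at hv ⊢
      exact ⟨⟨Nat.one_le_iff_ne_zero.2 hv.2.1, h.A_le v⟩, hv.2.2⟩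
    · intro x hx y hy hxy
      simp only [Finset.mem_filter] at hx hy
      rw [← h.O_A x hx.2.1, ← h.O_A y hy.2.1, hxy]
    · intro u hu
      simp only [Finset.mem_filter, Finset.mem_Icc] at hu
      have hO : O u ≠ 0 := fun h0 => by have := h.P_free u h0; omega
      refine ⟨O u, ?_, h.A_O u hO⟩
      simp only [Finset.mem_filter, Finset.mem_Icc, h.A_O u hO]
      exact ⟨⟨Nat.one_le_iff_ne_zero.2 hO, h.O_le u⟩, by omega, hu.2⟩
  rw [← heq, ← Finset.card_union_of_disjoint hdisj, ← Finset.filter_or]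
  congr 1
  ext v
  simp only [Finset.mem_filter]
  tauto

/-- If some buyer holds nothing, then at most `n - 1` objects have positive prices, so that one of
the prices `1, …, n` does not occur. -/
theorem exists_gap (h : AuctionInv n adj A O P) {v : ℕ} (hv : 1 ≤ v) (hvn : v ≤ n)
    (hA : A v = 0) : ∃ t, 1 ≤ t ∧ t ≤ n ∧ ∀ u, 1 ≤ u → u ≤ n → P u ≠ t := by
  by_contra hcon
  push Not at hcon
  have hsub : Finset.Icc 1 n ⊆ (((Finset.Icc 1 n).erase v).image A).image P := by
    intro t ht
    rw [Finset.mem_Icc] at ht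
    obtain ⟨u, hu, hun, hPu⟩ := hcon t ht.1 ht.2
    have hO : O u ≠ 0 := fun h0 => by have := h.P_free u h0; omega
    refine Finset.mem_image.2 ⟨u, Finset.mem_image.2 ⟨O u, ?_, h.A_O u hO⟩, hPu⟩
    rw [Finset.mem_erase, Finset.mem_Icc]
    refine ⟨fun he => ?_, Nat.one_le_iff_ne_zero.2 hO, h.O_le u⟩
    have := h.A_O u hO
    rw [he, hA] at this
    omega
  have h1 := Finset.card_le_card hsub
  have h2 := Finset.card_image_le (s := ((Finset.Icc 1 n).erase v).image A) (f := P)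
  have h3 := Finset.card_image_le (s := (Finset.Icc 1 n).erase v) (f := A)
  rw [Finset.card_erase_of_mem (Finset.mem_Icc.2 ⟨hv, hvn⟩)] at h3
  simp only [Nat.card_Icc] at h1 h3
  omega

/-- In a graph with a perfect matching `μ`, each buyer ends up with an object. -/
theorem ne_zero_of_perfect (h : AuctionInv n adj A O P) (hover : AuctionOver n adj A P)
    {μ : ℕ → ℕ} (hμ : ∀ v ∈ Finset.Icc 1 n, μ v ∈ Finset.Icc 1 n ∧ adj (μ v) v)
    (hinj : Set.InjOn μ (Finset.Icc 1 n)) {v : ℕ} (hv : 1 ≤ v) (hvn : v ≤ n) : A v ≠ 0 := by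
  intro hA
  obtain ⟨t, ht, htn, hgap⟩ := h.exists_gap hv hvn hA
  have h1 : ((Finset.Icc 1 n).filter (fun v => A v = 0 ∨ t < P (A v))).card ≤
      ((Finset.Icc 1 n).filter (fun u => t < P u)).card := by
    refine Finset.card_le_card_of_injOn μ ?_ (hinj.mono (by intro x hx; simpa using (Finset.mem_filter.1 hx).1))
    intro x hx
    simp only [Finset.coe_filter, Set.mem_ofPred_eq] at hx
    obtain ⟨hm, ha⟩ := hμ x hx.1
    have hxI := Finset.mem_Icc.1 hx.1
    have hmI := Finset.mem_Icc.1 hm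
    exact Finset.mem_filter.2
      ⟨hm, h.lt_price hover htn hgap hxI.1 hxI.2 hmI.1 hmI.2 hx.2 ha⟩
  have h2 := h.card_buyers_eq t
  have h3 : 0 < ((Finset.Icc 1 n).filter (fun v => A v = 0)).card :=
    Finset.card_pos.2 ⟨v, Finset.mem_filter.2 ⟨Finset.mem_Icc.2 ⟨hv, hvn⟩, hA⟩⟩
  omega

end AuctionInv

/-! ### The auction as a program -/

/-- The expression whose value is the index of the cell `(u, v)` of the adjacency matrix, rows and
columns being numbered from `1`, once array `2` holds the multiples of `n`. -/
def cellIndex (u v : Exp) : Exp :=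
  .add (.get 2 (.sub u (.lit 1))) (.sub v (.lit 1))

/-- The graph stored in array `0`, on `{1, …, n}` and `{1, …, n}`. -/
def storedAdj (B mul : ℕ → ℕ) (u v : ℕ) : Prop := B (mul (u - 1) + (v - 1)) ≠ 0

namespace ForProg

/-- Find a cheapest neighbor of the buyer in register `1` among those with price at most `n`; its
price is left in register `3`, and its number in register `4`. -/
def scan (P : ℕ) : ForProg :=
  forTo 2 (ite (.get 0 (cellIndex (.reg 2) (.reg 1)))
    (ite (.sub (.reg 3) (.get P (.reg 2)))
      (seq (assign 3 (.get P (.reg 2))) (assign 4 (.reg 2))) skip) skip)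

/-- The buyer in register `1` bids for the object in register `4`, if it needs one and the object
exists. The cell `0` of array `A` absorbs the update for an object without a previous owner. -/
def place (A O P : ℕ) : ForProg :=
  ite (.reg 4) (ite (.get A (.reg 1)) skip
    (seq (store A (.get O (.reg 4)) (.lit 0)) (seq (store O (.reg 4) (.reg 1))
      (seq (store A (.reg 1) (.reg 4))
        (store P (.reg 4) (.add (.get P (.reg 4)) (.lit 1))))))) skip

/-- The turn of the buyer in register `1`. -/
def turn (A O P : ℕ) : ForProg :=
  seq (assign 3 (.add (.reg 0) (.lit 1))) (seq (assign 4 (.lit 0)) (seq (scan P) (place A O P)))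

/-- One turn for each buyer. -/
def round (A O P : ℕ) : ForProg := forTo 1 (turn A O P)

/-- The auction. Each round before the end raises a price, and the sum of the prices is at most
`n * (n + 1)`, so `3 * n ^ 2` rounds are enough. -/
def auction (A O P : ℕ) : ForProg :=
  forTo 5 (forTo 6 (seq (round A O P) (seq (round A O P) (round A O P))))

theorem scan_spec {n P : ℕ} {s : State} (h3 : s.reg 3 = n + 1) (h4 : s.reg 4 = 0) :
    ((scan P).sem n s).arr = s.arr ∧ ((scan P).sem n s).reg 1 = s.reg 1 ∧
    ((((scan P).sem n s).reg 4 = 0 ∧ ∀ u, 1 ≤ u → u ≤ n →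
        storedAdj (s.arr 0) (s.arr 2) u (s.reg 1) → n + 1 ≤ s.arr P u) ∨
      ∃ u, ((scan P).sem n s).reg 4 = u ∧ 1 ≤ u ∧ u ≤ n ∧
        storedAdj (s.arr 0) (s.arr 2) u (s.reg 1) ∧ s.arr P u ≤ n ∧
        ∀ u', 1 ≤ u' → u' ≤ n → storedAdj (s.arr 0) (s.arr 2) u' (s.reg 1) →
          s.arr P u ≤ s.arr P u') := by
  set adj := storedAdj (s.arr 0) (s.arr 2) with hadj
  have key := sem_forTo_induct (n := n) (x := 2) (s := s)
    (c := ite (.get 0 (cellIndex (.reg 2) (.reg 1)))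
      (ite (.sub (.reg 3) (.get P (.reg 2)))
        (seq (assign 3 (.get P (.reg 2))) (assign 4 (.reg 2))) skip) skip)
    (fun i t => t.arr = s.arr ∧ t.reg 1 = s.reg 1 ∧
      ((t.reg 4 = 0 ∧ t.reg 3 = n + 1 ∧ ∀ u, 1 ≤ u → u ≤ i → adj u (s.reg 1) → n + 1 ≤ s.arr P u) ∨
        ∃ u, t.reg 4 = u ∧ t.reg 3 = s.arr P u ∧ 1 ≤ u ∧ u ≤ i ∧ adj u (s.reg 1) ∧
          s.arr P u ≤ n ∧ ∀ u', 1 ≤ u' → u' ≤ i → adj u' (s.reg 1) → s.arr P u ≤ s.arr P u'))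
    ⟨rfl, by simp, Or.inl ⟨by simp [h4], by simp [h3], fun u h1 h2 => by omega⟩⟩ ?_
  · obtain ⟨k1, k2, k3⟩ := key
    refine ⟨k1, k2, ?_⟩
    rcases k3 with ⟨k3, -, k4⟩ | ⟨u, k3, -, k4⟩
    · exact Or.inl ⟨k3, k4⟩
    · exact Or.inr ⟨u, k3, k4⟩
  · intro i hi t ⟨ht1, ht2, ht3⟩
    have hsucc : ∀ {p : ℕ → Prop}, (∀ u, 1 ≤ u → u ≤ i → adj u (s.reg 1) → p u) →
        (adj (i + 1) (s.reg 1) → p (i + 1)) →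
        ∀ u, 1 ≤ u → u ≤ i + 1 → adj u (s.reg 1) → p u := by
      intro p h1 h2 u hu hui hadj
      rcases Nat.lt_or_ge i u with h | h
      · obtain rfl : u = i + 1 := by omega
        exact h2 hadj
      · exact h1 u hu h hadj
    have e1 : Exp.eval (t.setReg 2 (i + 1)) (.get 0 (cellIndex (.reg 2) (.reg 1))) ≠ 0 ↔
        adj (i + 1) (s.reg 1) := by
      simp [Exp.eval, cellIndex, ht1, ht2, hadj, storedAdj]
    have e2 : Exp.eval (t.setReg 2 (i + 1)) (.sub (.reg 3) (.get P (.reg 2))) ≠ 0 ↔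
        s.arr P (i + 1) < t.reg 3 := by
      simp [Exp.eval, ht1]; omega
    simp only [sem, e2]
    split_ifs with c1 c2
    · refine ⟨by simpa using ht1, by simpa using ht2, Or.inr ⟨i + 1, by simp [Exp.eval],
        by simp [Exp.eval, ht1], by omega, le_rfl, e1.1 c1, ?_, ?_⟩⟩
      · rcases ht3 with ⟨_, h, _⟩ | ⟨u, _, h, _, _, _, h', _⟩ <;> omega
      · refine hsucc (fun u hu hui hadj => ?_) (fun _ => le_rfl)
        rcases ht3 with ⟨_, h, h'⟩ | ⟨u', _, h, _, _, _, h'', h'⟩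
        · have := h' u hu hui hadj; omega
        · have := h' u hu hui hadj; omega
    · refine ⟨by simpa using ht1, by simpa using ht2, ?_⟩
      rcases ht3 with ⟨h, h', h''⟩ | ⟨u, h, h', h1, h2, h3, h4, h5⟩
      · exact Or.inl ⟨by simpa using h, by simpa using h', hsucc h'' (fun _ => by omega)⟩
      · exact Or.inr ⟨u, by simpa using h, by simpa using h', h1, by omega, h3, h4,
          hsucc h5 (fun _ => by omega)⟩
    · refine ⟨by simpa using ht1, by simpa using ht2, ?_⟩
      rcases ht3 with ⟨h, h', h''⟩ | ⟨u, h, h', h1, h2, h3, h4, h5⟩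
      · exact Or.inl ⟨by simpa using h, by simpa using h', hsucc h'' (fun h => absurd (e1.2 h) c1)⟩
      · exact Or.inr ⟨u, by simpa using h, by simpa using h', h1, by omega, h3, h4,
          hsucc h5 (fun h => absurd (e1.2 h) c1)⟩

theorem sum_update_succ {n u : ℕ} (P : ℕ → ℕ) (hu : 1 ≤ u) (hun : u ≤ n) :
    ∑ x ∈ Finset.Icc 1 n, Function.update P u (P u + 1) x = (∑ x ∈ Finset.Icc 1 n, P x) + 1 := by
  have hmem : u ∈ Finset.Icc 1 n := Finset.mem_Icc.2 ⟨hu, hun⟩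
  rw [Finset.sum_update_of_mem hmem, ← Finset.add_sum_erase _ P hmem, Finset.sdiff_singleton_eq_erase]
  omega

/-- A turn of the buyer `v` preserves the invariant; either it changes nothing, and then `v` has an
object or no affordable neighbor, or it raises a price. -/
theorem turn_spec {n A O P v : ℕ} (hAO : A ≠ O) (hAP : A ≠ P) (hOP : O ≠ P) {s : State}
    (h0 : s.reg 0 = n) (h1 : s.reg 1 = v) (hv : 1 ≤ v) (hvn : v ≤ n)
    (hinv : AuctionInv n (storedAdj (s.arr 0) (s.arr 2)) (s.arr A) (s.arr O) (s.arr P)) :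
    AuctionInv n (storedAdj (s.arr 0) (s.arr 2)) (((turn A O P).sem n s).arr A)
      (((turn A O P).sem n s).arr O) (((turn A O P).sem n s).arr P) ∧
    ((((turn A O P).sem n s).arr = s.arr ∧ (s.arr A v = 0 → ∀ u, 1 ≤ u → u ≤ n →
        storedAdj (s.arr 0) (s.arr 2) u v → n + 1 ≤ s.arr P u)) ∨
      (s.arr A v = 0 ∧ (∃ u, 1 ≤ u ∧ u ≤ n ∧ storedAdj (s.arr 0) (s.arr 2) u v ∧ s.arr P u ≤ n) ∧
        ∑ u ∈ Finset.Icc 1 n, ((turn A O P).sem n s).arr P u =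
          (∑ u ∈ Finset.Icc 1 n, s.arr P u) + 1)) := by
  set s₁ := (s.setReg 3 (n + 1)).setReg 4 0 with hs₁
  have hturn : (turn A O P).sem n s = (place A O P).sem n ((scan P).sem n s₁) := by
    simp [turn, sem, Exp.eval, h0, hs₁]
  rw [hturn]
  obtain ⟨k1, k2, k3⟩ := scan_spec (n := n) (P := P) (s := s₁) (by simp [hs₁]) (by simp [hs₁])
  set s₂ := (scan P).sem n s₁
  have hv₁ : s₁.reg 1 = v := by simp [hs₁, h1]
  have harr : s₁.arr = s.arr := rfl
  rw [hv₁] at k2 k3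
  rw [harr] at k1 k3
  rcases k3 with ⟨k3, k4⟩ | ⟨u, k3, hu, hun, huv, hP, hmin⟩
  · have : (place A O P).sem n s₂ = s₂ := by simp [place, sem, Exp.eval, k3]
    rw [this, k1]
    exact ⟨hinv, Or.inl ⟨rfl, fun _ => k4⟩⟩
  · by_cases hA : s.arr A v = 0
    · have hu0 : u ≠ 0 := by omega
      have hres : ((place A O P).sem n s₂).arr A =
            Function.update (Function.update (s.arr A) (s.arr O u) 0) v u ∧
          ((place A O P).sem n s₂).arr O = Function.update (s.arr O) u v ∧
          ((place A O P).sem n s₂).arr P = Function.update (s.arr P) u (s.arr P u + 1) := by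
        simp [place, sem, Exp.eval, k1, k2, k3, hA, hu0, hAO, hAO.symm, hAP, hAP.symm, hOP,
          hOP.symm]
      rw [hres.1, hres.2.1, hres.2.2]
      exact ⟨hinv.bid hv hvn hA hu hun huv hP hmin,
        Or.inr ⟨hA, ⟨u, hu, hun, huv, hP⟩, sum_update_succ _ hu hun⟩⟩
    · have : (place A O P).sem n s₂ = s₂ := by
        simp [place, sem, Exp.eval, k1, k2, hA]
      rw [this, k1]
      exact ⟨hinv, Or.inl ⟨rfl, fun h => absurd h hA⟩⟩

/-- The state of the auction on the graph stored in `B` and `mul`: it is over, or the sum of the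
prices is at least `r`. -/
structure AuctionState (n A O P : ℕ) (B mul : ℕ → ℕ) (r : ℕ) (s : State) : Prop where
  bound : s.reg 0 = n
  matrix : s.arr 0 = B
  table : s.arr 2 = mul
  inv : AuctionInv n (storedAdj B mul) (s.arr A) (s.arr O) (s.arr P)
  progress : AuctionOver n (storedAdj B mul) (s.arr A) (s.arr P) ∨
    r ≤ ∑ u ∈ Finset.Icc 1 n, s.arr P u

theorem AuctionState.setReg {n A O P : ℕ} {B mul : ℕ → ℕ} {r : ℕ} {s : State}
    (h : AuctionState n A O P B mul r s) {x : ℕ} (hx : x ≠ 0) (k : ℕ) :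
    AuctionState n A O P B mul r (s.setReg x k) :=
  ⟨by simp [hx.symm, h.bound], h.matrix, h.table, h.inv, h.progress⟩

theorem AuctionState.round {n A O P : ℕ} {B mul : ℕ → ℕ} {r : ℕ} {s : State}
    (hAO : A ≠ O) (hAP : A ≠ P) (hOP : O ≠ P) (hA : A ≠ 0 ∧ A ≠ 2) (hO : O ≠ 0 ∧ O ≠ 2)
    (hP : P ≠ 0 ∧ P ≠ 2) (h : AuctionState n A O P B mul r s) :
    AuctionState n A O P B mul (r + 1) ((ForProg.round A O P).sem n s) := by
  have key := sem_forTo_induct (n := n) (x := 1) (s := s) (c := turn A O P)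
    (fun i t => t.reg 0 = n ∧ t.arr 0 = B ∧ t.arr 2 = mul ∧
      AuctionInv n (storedAdj B mul) (t.arr A) (t.arr O) (t.arr P) ∧
      (AuctionOver n (storedAdj B mul) (t.arr A) (t.arr P) ∨
        r + 1 ≤ ∑ u ∈ Finset.Icc 1 n, t.arr P u ∨
        (r ≤ ∑ u ∈ Finset.Icc 1 n, t.arr P u ∧
          ∀ v, 1 ≤ v → v ≤ i → t.arr A v = 0 → ∀ u, 1 ≤ u → u ≤ n → storedAdj B mul u v →
            n + 1 ≤ t.arr P u)))
    ⟨by simp [h.bound], h.matrix, h.table, h.inv, ?_⟩ ?_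
  · obtain ⟨k1, k2, k3, k4, k5⟩ := key
    refine ⟨k1, k2, k3, k4, ?_⟩
    rcases k5 with k5 | k5 | k5
    · exact Or.inl k5
    · exact Or.inr k5
    · exact Or.inl k5.2
  · rcases h.progress with hp | hp
    · exact Or.inl hp
    · exact Or.inr (Or.inr ⟨hp, fun v h1 h2 => by omega⟩)
  · intro i hi t ⟨k1, k2, k3, k4, k5⟩
    have hreg : ((turn A O P).sem n (t.setReg 1 (i + 1))).reg 0 = n := by
      rw [sem_reg_eq n _ _ (by simp [turn, scan, place, keepsReg])]
      simpa using k1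
    have hB : ((turn A O P).sem n (t.setReg 1 (i + 1))).arr 0 = B := by
      rw [sem_arr_eq n _ _ (by simp [turn, scan, place, keepsArr, hA, hO, hP])]
      simpa using k2
    have hm : ((turn A O P).sem n (t.setReg 1 (i + 1))).arr 2 = mul := by
      rw [sem_arr_eq n _ _ (by simp [turn, scan, place, keepsArr, hA, hO, hP])]
      simpa using k3
    obtain ⟨j1, j2⟩ := turn_spec (n := n) (v := i + 1) (s := t.setReg 1 (i + 1)) hAO hAP hOP
      (by simpa using k1) (by simp) (by omega) (by omega) (by simpa [k2, k3] using k4)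
    simp only [State.setReg_arr, k2, k3] at j1 j2
    refine ⟨hreg, hB, hm, j1, ?_⟩
    rcases j2 with ⟨j2, j3⟩ | ⟨j2, ⟨u, hu, hun, huv, hPu⟩, j4⟩
    · rw [j2]
      rcases k5 with k5 | k5 | ⟨k5, k6⟩
      · exact Or.inl k5
      · exact Or.inr (Or.inl k5)
      · refine Or.inr (Or.inr ⟨k5, fun v hv hvi => ?_⟩)
        rcases Nat.lt_or_ge i v with hlt | hge
        · obtain rfl : v = i + 1 := by omega
          exact j3
        · exact k6 v hv hge
    · rw [j4]
      rcases k5 with k5 | k5 | k5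
      · have := k5 (i + 1) (by omega) (by omega) j2 u hu hun huv
        omega
      · exact Or.inr (Or.inl (by omega))
      · exact Or.inr (Or.inl (by omega))

theorem AuctionState.forTo {n A O P : ℕ} {B mul : ℕ → ℕ} {c : ForProg} {x d : ℕ} (hx : x ≠ 0)
    (hc : ∀ r s, AuctionState n A O P B mul r s → AuctionState n A O P B mul (r + d) (c.sem n s))
    {r : ℕ} {s : State} (h : AuctionState n A O P B mul r s) :
    AuctionState n A O P B mul (r + n * d) ((ForProg.forTo x c).sem n s) := by
  refine sem_forTo_induct (fun i t => AuctionState n A O P B mul (r + i * d) t) ?_ ?_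
  · simpa using h.setReg hx 0
  · intro i _ t ht
    have := hc _ _ (ht.setReg hx (i + 1))
    rwa [show r + (i + 1) * d = r + i * d + d by ring]

/-- Started with nothing sold and all prices `0`, the auction program plays the auction to its
end. -/
theorem auction_spec {n A O P : ℕ} (hAO : A ≠ O) (hAP : A ≠ P) (hOP : O ≠ P)
    (hA : A ≠ 0 ∧ A ≠ 2) (hO : O ≠ 0 ∧ O ≠ 2) (hP : P ≠ 0 ∧ P ≠ 2) {s : State}
    (h0 : s.reg 0 = n) (hsA : ∀ i, s.arr A i = 0) (hsO : ∀ i, s.arr O i = 0)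
    (hsP : ∀ i, s.arr P i = 0) :
    AuctionInv n (storedAdj (s.arr 0) (s.arr 2)) (((auction A O P).sem n s).arr A)
      (((auction A O P).sem n s).arr O) (((auction A O P).sem n s).arr P) ∧
    AuctionOver n (storedAdj (s.arr 0) (s.arr 2)) (((auction A O P).sem n s).arr A)
      (((auction A O P).sem n s).arr P) := by
  have hinit : AuctionState n A O P (s.arr 0) (s.arr 2) 0 s := by
    refine ⟨h0, rfl, rfl, ?_, Or.inr (by simp)⟩
    constructor <;> simp [hsA, hsO, hsP]
  have hround := fun r t (h : AuctionState n A O P (s.arr 0) (s.arr 2) r t) =>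
    h.round hAO hAP hOP hA hO hP
  have hbody := fun r t (h : AuctionState n A O P (s.arr 0) (s.arr 2) r t) =>
    hround _ _ (hround _ _ (hround _ _ h))
  have hinner := fun r t (h : AuctionState n A O P (s.arr 0) (s.arr 2) r t) =>
    AuctionState.forTo (x := 6) (d := 3)
      (c := seq (ForProg.round A O P) (seq (ForProg.round A O P) (ForProg.round A O P)))
      (by decide) hbody h
  have h := AuctionState.forTo (x := 5) (by decide) hinner hinit
  refine ⟨h.inv, ?_⟩
  rcases h.progress with hp | hp
  · exact hp
  · have hle := h.inv.sum_price_le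
    intro v hv hvn
    have : 0 + n * (n * 3) ≤ n * (n + 1) := hp.trans hle
    nlinarith

end ForProg

/-! ### Two matchings and the priorities derived from them -/

/-- A perfect matching `A₁` (with inverse `O₁`) of the graph `adj`, and the result of the auction on
the graph `adj'` that remains after the edges of `A₁` are deleted. Vertices of both sides are
numbered from `1` to `n`. -/
structure TwoMatchings (n : ℕ) (adj adj' : ℕ → ℕ → Prop) (A₁ O₁ A₂ O₂ P₂ : ℕ → ℕ) : Prop where
  A_mem : ∀ v, 1 ≤ v → v ≤ n → 1 ≤ A₁ v ∧ A₁ v ≤ n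
  O_A : ∀ v, 1 ≤ v → v ≤ n → O₁ (A₁ v) = v
  O_zero : O₁ 0 = 0
  adj_A : ∀ v, 1 ≤ v → v ≤ n → adj (A₁ v) v
  adj_iff : ∀ u v, 1 ≤ u → u ≤ n → 1 ≤ v → v ≤ n → (adj' u v ↔ adj u v ∧ u ≠ A₁ v)
  inv : AuctionInv n adj' A₂ O₂ P₂
  finished : AuctionOver n adj' A₂ P₂

/-- The priorities `key` guarantee a matching of the desired size. Left vertices are renamed by
`A₁`. -/
def GoodKey (n : ℕ) (adj : ℕ → ℕ → Prop) (A₁ key : ℕ → ℕ) : Prop :=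
  ∀ (W P : Finset ℕ) (m : ℕ → ℕ),
    Outcome (Finset.Icc 1 n) W P (fun i j => adj (A₁ i) j) key m → n ≤ 43 * (P \ W).card

namespace TwoMatchings

variable {n : ℕ} {adj adj' : ℕ → ℕ → Prop} {A₁ O₁ A₂ O₂ P₂ key : ℕ → ℕ}

theorem injOn (h : TwoMatchings n adj adj' A₁ O₁ A₂ O₂ P₂) :
    Set.InjOn A₁ (Finset.Icc 1 n) := fun x hx y hy hxy => by
  have hx := Finset.mem_Icc.1 (Finset.mem_coe.1 hx)
  have hy := Finset.mem_Icc.1 (Finset.mem_coe.1 hy)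
  rw [← h.O_A x hx.1 hx.2, ← h.O_A y hy.1 hy.2, hxy]

theorem exists_eq (h : TwoMatchings n adj adj' A₁ O₁ A₂ O₂ P₂) {u : ℕ} (hu : 1 ≤ u)
    (hun : u ≤ n) : ∃ v, 1 ≤ v ∧ v ≤ n ∧ A₁ v = u := by
  have himg : (Finset.Icc 1 n).image A₁ = Finset.Icc 1 n := by
    apply Finset.eq_of_subset_of_card_le
    · intro x hx
      obtain ⟨v, hv, rfl⟩ := Finset.mem_image.1 hx
      rw [Finset.mem_Icc] at hv ⊢
      exact h.A_mem v hv.1 hv.2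
    · rw [Finset.card_image_of_injOn h.injOn]
  have hmem : u ∈ (Finset.Icc 1 n).image A₁ := by
    rw [himg]
    exact Finset.mem_Icc.2 ⟨hu, hun⟩
  obtain ⟨v, hv, he⟩ := Finset.mem_image.1 hmem
  rw [Finset.mem_Icc] at hv
  exact ⟨v, hv.1, hv.2, he⟩

theorem O_mem (h : TwoMatchings n adj adj' A₁ O₁ A₂ O₂ P₂) {u : ℕ} (hu : 1 ≤ u) (hun : u ≤ n) :
    1 ≤ O₁ u ∧ O₁ u ≤ n ∧ A₁ (O₁ u) = u := by
  obtain ⟨v, hv, hvn, rfl⟩ := h.exists_eq hu hun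
  rw [h.O_A v hv hvn]
  exact ⟨hv, hvn, rfl⟩

/-- If the second matching misses many vertices, then a gap `t` in the prices yields sets `Y` and
`Z` as in `Outcome.deficiency_le`. -/
theorem goodKey_of_gap (h : TwoMatchings n adj adj' A₁ O₁ A₂ O₂ P₂) {t : ℕ}
    (htn : t ≤ n) (hgap : ∀ u, 1 ≤ u → u ≤ n → P₂ u ≠ t)
    (hcard : n ≤ 43 * ((Finset.Icc 1 n).filter (fun v => A₂ v = 0)).card)
    (hkey : ∀ v, 1 ≤ v → v ≤ n → key v = if A₂ v = 0 ∨ t < P₂ (A₂ v) then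
      (if t < P₂ (A₁ v) then 0 else 1) else 2) :
    GoodKey n adj A₁ key := by
  intro W P m ho
  have hZc : ((Finset.Icc 1 n).filter (fun v => t < P₂ (A₁ v))).card =
      ((Finset.Icc 1 n).filter (fun u => t < P₂ u)).card := by
    refine Finset.card_bij (fun v _ => A₁ v) ?_ ?_ ?_
    · intro v hv
      simp only [Finset.mem_filter, Finset.mem_Icc] at hv ⊢
      exact ⟨h.A_mem v hv.1.1 hv.1.2, hv.2⟩
    · intro x hx y hy hxy
      exact h.injOn (Finset.mem_coe.2 (Finset.mem_filter.1 hx).1)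
        (Finset.mem_coe.2 (Finset.mem_filter.1 hy).1) hxy
    · intro u hu
      simp only [Finset.mem_filter, Finset.mem_Icc] at hu
      obtain ⟨v, hv, hvn, rfl⟩ := h.exists_eq hu.1.1 hu.1.2
      exact ⟨v, by simpa [hv, hvn] using hu.2, rfl⟩
  have hYc := h.inv.card_buyers_eq t
  have hle := ho.deficiency_le
    (Y := (Finset.Icc 1 n).filter (fun v => A₂ v = 0 ∨ t < P₂ (A₂ v)))
    (Z := (Finset.Icc 1 n).filter (fun v => t < P₂ (A₁ v))) (Finset.filter_subset _ _) ?_ ?_ ?_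
  · omega
  · intro y hy i hi hiy hne
    simp only [Finset.mem_filter, Finset.mem_Icc] at hy hi ⊢
    obtain ⟨hA, hAn⟩ := h.A_mem i hi.1 hi.2
    refine ⟨hi, h.inv.lt_price h.finished htn hgap hy.1.1 hy.1.2 hA hAn hy.2 ?_⟩
    refine (h.adj_iff _ _ hA hAn hy.1.1 hy.1.2).2 ⟨hiy, fun he => hne ?_⟩
    rw [← h.O_A i hi.1 hi.2, he, h.O_A y hy.1.1 hy.1.2]
  · intro v hv
    have hv' := Finset.mem_Icc.1 hv
    rw [hkey v hv'.1 hv'.2]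
    simp only [Finset.mem_filter, hv, true_and]
    split_ifs <;> simp_all
  · intro v hv
    have hv' := Finset.mem_Icc.1 hv
    rw [hkey v hv'.1 hv'.2]
    simp only [Finset.mem_filter, hv, true_and]
    split_ifs <;> simp_all

/-- If the second matching misses few vertices, then a maximal independent set `F` of the paths and
cycles formed by the two matchings yields the order of `Outcome.card_le_of_independent`. Here
`v ↦ O₁ (A₂ v)` goes one step along these paths and cycles, and `v ↦ O₂ (A₁ v)` goes back. -/
theorem goodKey_of_independent (h : TwoMatchings n adj adj' A₁ O₁ A₂ O₂ P₂) {F : ℕ → ℕ}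
    (hF0 : F 0 = 0)
    (hcard : 43 * ((Finset.Icc 1 n).filter (fun v => A₂ v = 0)).card < n)
    (hind : ∀ v, F v ≠ 0 → F (O₁ (A₂ v)) = 0)
    (hmax : ∀ v, 1 ≤ v → v ≤ n → F v = 0 → F (O₁ (A₂ v)) ≠ 0 ∨ F (O₂ (A₁ v)) ≠ 0)
    (hkey : ∀ v, 1 ≤ v → v ≤ n → key v = if F v ≠ 0 then
      (if F (O₂ (A₁ (O₂ (A₁ v)))) ≠ 0 then 1 else 0) else 2) :
    GoodKey n adj A₁ key := by
  intro W P m ho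
  have hA₂ : ∀ v, A₂ v ≠ 0 → 1 ≤ A₂ v ∧ A₂ v ≤ n := fun v hv =>
    ⟨Nat.one_le_iff_ne_zero.2 hv, h.inv.A_le v⟩
  have hback : ∀ v, A₂ v ≠ 0 → O₂ (A₁ (O₁ (A₂ v))) = v := fun v hv => by
    rw [(h.O_mem (hA₂ v hv).1 (hA₂ v hv).2).2.2, h.inv.O_A v hv]
  have hVQ : Finset.Icc 1 n \ (Finset.Icc 1 n).filter (fun v => A₂ v ≠ 0) =
      (Finset.Icc 1 n).filter (fun v => A₂ v = 0) := by
    ext v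
    simp only [Finset.mem_sdiff, Finset.mem_filter]
    tauto
  have hle := ho.card_le_of_independent
    (Q := (Finset.Icc 1 n).filter (fun v => A₂ v ≠ 0)) (f := fun v => O₁ (A₂ v))
    (F := (Finset.Icc 1 n).filter (fun v => F v ≠ 0))
    (F₃ := (Finset.Icc 1 n).filter (fun v => F v ≠ 0 ∧ F (O₂ (A₁ (O₂ (A₁ v)))) = 0))
    (Finset.filter_subset _ _) ?_ ?_ ?_ (Finset.filter_subset _ _) ?_ ?_ ?_ ?_ ?_ ?_ ?_
  · simpa using hle
  · intro q hq
    have hq := (Finset.mem_filter.1 hq).2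
    obtain ⟨h1, h2, -⟩ := h.O_mem (hA₂ q hq).1 (hA₂ q hq).2
    exact Finset.mem_Icc.2 ⟨h1, h2⟩
  · intro q hq
    obtain ⟨hqV, hq⟩ := Finset.mem_filter.1 hq
    have hqV := Finset.mem_Icc.1 hqV
    obtain ⟨-, -, h3⟩ := h.O_mem (hA₂ q hq).1 (hA₂ q hq).2
    simp only [h3]
    exact ((h.adj_iff _ _ (hA₂ q hq).1 (hA₂ q hq).2 hqV.1 hqV.2).1 (h.inv.adj_A q hq)).1
  · intro x hx y hy hxy
    have hx := (Finset.mem_filter.1 (Finset.mem_coe.1 hx)).2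
    have hy := (Finset.mem_filter.1 (Finset.mem_coe.1 hy)).2
    simp only at hxy
    rw [← hback x hx, ← hback y hy, hxy]
  · intro v hv
    simp only [Finset.mem_filter] at hv ⊢
    exact ⟨hv.1, hv.2.1⟩
  · intro q hq hqF hfq
    exact (Finset.mem_filter.1 hfq).2 (hind q (Finset.mem_filter.1 hqF).2)
  · intro v hv hvF
    have hv' := Finset.mem_Icc.1 hv
    have hF : F v = 0 := by
      by_contra h0
      exact hvF (Finset.mem_filter.2 ⟨hv, h0⟩)
    rcases hmax v hv'.1 hv'.2 hF with h1 | h1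
    · have hA : A₂ v ≠ 0 := fun h0 => h1 (by rw [h0, h.O_zero, hF0])
      obtain ⟨h2, h3, -⟩ := h.O_mem (hA₂ v hA).1 (hA₂ v hA).2
      exact Or.inl ⟨Finset.mem_filter.2 ⟨hv, hA⟩,
        Finset.mem_filter.2 ⟨Finset.mem_Icc.2 ⟨h2, h3⟩, h1⟩⟩
    · have hO : O₂ (A₁ v) ≠ 0 := fun h0 => h1 (by rw [h0, hF0])
      have hA := h.inv.A_O _ hO
      have hmem : O₂ (A₁ v) ∈ Finset.Icc 1 n :=
        Finset.mem_Icc.2 ⟨Nat.one_le_iff_ne_zero.2 hO, h.inv.O_le _⟩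
      have hA1 := (h.A_mem v hv'.1 hv'.2).1
      refine Or.inr ⟨O₂ (A₁ v), Finset.mem_filter.2 ⟨hmem, by omega⟩,
        Finset.mem_filter.2 ⟨hmem, h1⟩, ?_⟩
      simp only [hA, h.O_A v hv'.1 hv'.2]
  · intro q hq hfq hffq
    obtain ⟨hqV, hqA⟩ := Finset.mem_filter.1 hq
    have hfA := (Finset.mem_filter.1 hfq).2
    obtain ⟨hffV, hffF⟩ := Finset.mem_filter.1 hffq
    simp only [Finset.mem_filter, hffV, hqV, hback _ hfA, hback _ hqA]
    simpa using fun _ => hffF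
  · intro v hv
    have hv' := Finset.mem_Icc.1 hv
    rw [hkey v hv'.1 hv'.2]
    simp only [Finset.mem_filter, hv, true_and]
    split_ifs <;> simp_all
  · intro v hv
    have hv' := Finset.mem_Icc.1 hv
    rw [hkey v hv'.1 hv'.2]
    simp only [Finset.mem_filter, hv, true_and]
    split_ifs <;> simp_all
  · rw [hVQ]
    simpa using hcard

end TwoMatchings

/-- The edge set `E`, with the vertices of both sides numbered from `1` to `n`. -/
def IsEdge {n : ℕ} (E : Finset (Fin n × Fin n)) (u v : ℕ) : Prop :=
  ∃ e ∈ E, u = (e.1 : ℕ) + 1 ∧ v = (e.2 : ℕ) + 1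

/-- A greedy matching for an order that respects good priorities has the desired size. -/
theorem IsGreedyOutcome.card_ge {n : ℕ} {E : Finset (Fin n × Fin n)} {adj' : ℕ → ℕ → Prop}
    {A₁ O₁ A₂ O₂ P₂ key : ℕ → ℕ} (h : TwoMatchings n (IsEdge E) adj' A₁ O₁ A₂ O₂ P₂)
    (hgood : GoodKey n (IsEdge E) A₁ key) {π : Fin n ≃ Fin n}
    (hπ : ∀ a b, π.symm a < π.symm b → key (a + 1) ≤ key (b + 1)) {M : Finset (Fin n × Fin n)}
    (hg : IsGreedyOutcome E π M) : 44 * n ≤ 86 * M.card := by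
  classical
  set W := (Finset.Icc 1 n).filter (fun v => ∀ e ∈ M, (e.2 : ℕ) + 1 ≠ v) with hW
  set P := (Finset.Icc 1 n).filter (fun i => ∃ e ∈ M, (e.1 : ℕ) + 1 = A₁ i) with hP
  have hm : ∀ i, ∃ j, i ∈ P → ∃ e ∈ M, (e.1 : ℕ) + 1 = A₁ i ∧ j = (e.2 : ℕ) + 1 := by
    intro i
    by_cases hi : i ∈ P
    · obtain ⟨e, he, h1⟩ := (Finset.mem_filter.1 hi).2
      exact ⟨_, fun _ => ⟨e, he, h1, rfl⟩⟩
    · exact ⟨0, fun h => absurd h hi⟩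
  choose m hm using hm
  have hPc : P.card = M.card := by
    symm
    refine Finset.card_bij (fun e _ => O₁ (e.1 + 1)) ?_ ?_ ?_
    · intro e he
      obtain ⟨h1, h2, h3⟩ := h.O_mem (u := e.1 + 1) (by omega) (by omega)
      exact Finset.mem_filter.2 ⟨Finset.mem_Icc.2 ⟨h1, h2⟩, e, he, h3.symm⟩
    · intro e he e' he' hee
      have h1 := (h.O_mem (u := e.1 + 1) (by omega) (by omega)).2.2
      have h2 := (h.O_mem (u := e'.1 + 1) (by omega) (by omega)).2.2
      rw [hee, h2] at h1
      have h3 : e.1 = e'.1 := Fin.ext (by omega)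
      refine Prod.ext h3 (hg.left_inj e.1 e.2 e'.2 he ?_)
      rw [h3]
      exact he'
    · intro i hi
      obtain ⟨hiV, e, he, h1⟩ := Finset.mem_filter.1 hi
      have hiV := Finset.mem_Icc.1 hiV
      exact ⟨e, he, by rw [h1, h.O_A i hiV.1 hiV.2]⟩
  have hSc : (Finset.Icc 1 n \ W).card = M.card := by
    symm
    refine Finset.card_bij (fun e _ => (e.2 : ℕ) + 1) ?_ ?_ ?_
    · intro e he
      refine Finset.mem_sdiff.2 ⟨Finset.mem_Icc.2 ⟨by omega, by omega⟩, fun hw => ?_⟩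
      exact (Finset.mem_filter.1 hw).2 e he rfl
    · intro e he e' he' hee
      have h3 : e.2 = e'.2 := Fin.ext (by simpa using hee)
      refine Prod.ext (hg.right_inj e.1 e'.1 e.2 he ?_) h3
      rw [h3]
      exact he'
    · intro v hv
      obtain ⟨hvV, hvW⟩ := Finset.mem_sdiff.1 hv
      by_contra hcon
      exact hvW (Finset.mem_filter.2 ⟨hvV, fun e he hev => hcon ⟨e, he, hev⟩⟩)
  have hcard : P.card + W.card = (Finset.Icc 1 n).card := by
    rw [hPc, ← hSc]
    exact Finset.card_sdiff_add_card_eq_card (Finset.filter_subset _ _)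
  have hout : Outcome (Finset.Icc 1 n) W P (fun i j => IsEdge E (A₁ i) j) key m := by
    refine ⟨?_, Finset.filter_subset _ _, Finset.filter_subset _ _, ?_, ?_, hcard, ?_, ?_⟩
    · intro i hi
      have hi := Finset.mem_Icc.1 hi
      exact h.adj_A i hi.1 hi.2
    · intro i hi
      obtain ⟨e, he, -, h2⟩ := hm i hi
      rw [h2]
      refine Finset.mem_sdiff.2 ⟨Finset.mem_Icc.2 ⟨by omega, by omega⟩, fun hw => ?_⟩
      exact (Finset.mem_filter.1 hw).2 e he rfl
    · intro i hi j hj hij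
      obtain ⟨e, he, h1, h2⟩ := hm i hi
      obtain ⟨e', he', h1', h2'⟩ := hm j hj
      have h3 : e.2 = e'.2 := Fin.ext (by omega)
      have h4 : e.1 = e'.1 := hg.right_inj e.1 e'.1 e.2 he (by rw [h3]; exact he')
      refine h.injOn (Finset.mem_coe.2 (Finset.mem_filter.1 hi).1)
        (Finset.mem_coe.2 (Finset.mem_filter.1 hj).1) ?_
      rw [← h1, ← h1', h4]
    · intro i hi
      obtain ⟨e, he, h1, h2⟩ := hm i hi
      exact ⟨e, hg.subset he, h1.symm, h2⟩
    · intro j hj i hi hij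
      obtain ⟨e, he, h1, rfl⟩ := hij
      have hfree : ∀ e' ∈ M, e'.2 ≠ e.2 := fun e' he' hee =>
        (Finset.mem_filter.1 hj).2 e' he' (by rw [hee])
      obtain ⟨v', hv', hlt⟩ := hg.lower e.1 e.2 he hfree
      have hiP : i ∈ P := Finset.mem_filter.2 ⟨hi, (e.1, v'), hv', h1.symm⟩
      refine ⟨hiP, ?_⟩
      obtain ⟨e', he', h1', h2'⟩ := hm i hiP
      have h3 : e'.1 = e.1 := Fin.ext (by omega)
      have h4 : e'.2 = v' := hg.left_inj e'.1 e'.2 v' he' (by rw [h3]; exact hv')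
      rw [h2', h4]
      exact hπ _ _ hlt
  have h1 := hgood W P m hout
  have h2 := hout.card_sdiff_add
  simp only [Nat.card_Icc] at hcard h2
  omega

/-! ### The program -/

namespace ForProg

/-- An expression that is nonzero if and only if `a` and `b` have different values. -/
def neExp (a b : Exp) : Exp := .add (.sub a b) (.sub b a)

theorem eval_neExp {s : State} {a b : Exp} : (neExp a b).eval s ≠ 0 ↔ a.eval s ≠ b.eval s := by
  simp only [neExp, Exp.eval]
  omega

/-- Write the multiples of `n` into array `2`. -/
def mulTable : ForProg :=
  forTo 2 (store 2 (.reg 2) (.add (.get 2 (.sub (.reg 2) (.lit 1))) (.reg 0)))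

/-- Delete the edges of the matching in array `3` from the graph. -/
def deleteMatching : ForProg :=
  forTo 1 (store 0 (cellIndex (.get 3 (.reg 1)) (.reg 1)) (.lit 0))

/-- Write `43` times the number of buyers without an object into register `7`. -/
def countFree : ForProg :=
  seq (assign 7 (.lit 0))
    (forTo 1 (ite (.get 6 (.reg 1)) skip (assign 7 (.add (.reg 7) (.lit 43)))))

/-- Compute a perfect matching (arrays `3`, `4`), and then a second matching (arrays `6`, `7`,
with prices in array `8`) in the rest of the graph. -/
def prepare : ForProg :=
  seq mulTable (seq (auction 3 4 5) (seq deleteMatching (seq (auction 6 7 8) countFree)))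

/-- Find a price among `1, …, n` that no object has, and write it into register `8`. -/
def findGap : ForProg :=
  seq (assign 8 (.lit 0)) (forTo 5 (seq (assign 9 (.lit 0))
    (seq (forTo 2 (ite (neExp (.get 8 (.reg 2)) (.reg 5)) skip (assign 9 (.lit 1))))
      (ite (.reg 9) skip (assign 8 (.reg 5))))))

/-- The priorities of `TwoMatchings.goodKey_of_gap`, written into array `10`. Cell `0` of the price
array is set to `n + 1`, which makes buyers without an object pass for buyers of an expensive one. -/
def gapKeys : ForProg :=
  seq (store 8 (.lit 0) (.add (.reg 0) (.lit 1)))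
    (forTo 1 (ite (.sub (.get 8 (.get 6 (.reg 1))) (.reg 8))
      (ite (.sub (.get 8 (.get 3 (.reg 1))) (.reg 8))
        (store 10 (.reg 1) (.lit 0)) (store 10 (.reg 1) (.lit 1)))
      (store 10 (.reg 1) (.lit 2))))

/-- Choose greedily, in array `9`, a maximal set without two consecutive vertices of a path or cycle
formed by the two matchings. -/
def independentSet : ForProg :=
  forTo 1 (ite (.add (.get 9 (.get 4 (.get 6 (.reg 1)))) (.get 9 (.get 7 (.get 3 (.reg 1)))))
    skip (store 9 (.reg 1) (.lit 1)))

/-- The priorities of `TwoMatchings.goodKey_of_independent`, written into array `10`. -/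
def independentKeys : ForProg :=
  forTo 1 (ite (.get 9 (.reg 1))
    (ite (.get 9 (.get 7 (.get 3 (.get 7 (.get 3 (.reg 1))))))
      (store 10 (.reg 1) (.lit 1)) (store 10 (.reg 1) (.lit 0)))
    (store 10 (.reg 1) (.lit 2)))

/-- Append the vertices with priority `c` to the output. -/
def collect (c : ℕ) : ForProg :=
  forTo 1 (ite (neExp (.get 10 (.reg 1)) (.lit c)) skip
    (seq (store 1 (.reg 10) (.sub (.reg 1) (.lit 1))) (assign 10 (.add (.reg 10) (.lit 1)))))

/-- Output the vertices by increasing priority. -/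
def output : ForProg :=
  seq (assign 10 (.lit 0)) (seq (collect 0) (seq (collect 1) (collect 2)))

/-- The priorities: by a price gap if the second matching misses at least `n / 43` vertices, and by
an independent set otherwise. -/
def priorities : ForProg :=
  ite (.sub (.add (.reg 7) (.lit 1)) (.reg 0)) (seq findGap gapKeys)
    (seq independentSet independentKeys)

/-- The whole algorithm. -/
def greedyOrder : ForProg := seq prepare (seq priorities output)

theorem mulTable_spec {n : ℕ} {s : State} (h0 : s.reg 0 = n) (h2 : s.arr 2 0 = 0) :
    ∀ j ≤ n, (mulTable.sem n s).arr 2 j = j * n := by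
  refine (sem_forTo_induct (fun i t => t.reg 0 = n ∧ ∀ j ≤ i, t.arr 2 j = j * n) ?_ ?_).2
  · refine ⟨by simp [h0], fun j hj => ?_⟩
    obtain rfl : j = 0 := by omega
    simpa using h2
  · intro i hi t ⟨ht0, ht⟩
    refine ⟨by simp [sem, ht0], fun j hj => ?_⟩
    rcases Nat.lt_or_ge i j with hlt | hge
    · obtain rfl : j = i + 1 := by omega
      simp [sem, Exp.eval, ht0, ht i le_rfl]
      ring
    · have : j ≠ i + 1 := by omega
      simp [sem, Exp.eval, this, ht j hge]

theorem cell_inj {n a b a' b' : ℕ} (hb : b < n) (hb' : b' < n) (h : a * n + b = a' * n + b') :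
    a = a' ∧ b = b' := by
  have h1 := congrArg (· % n) h
  simp only [Nat.mul_add_mod', Nat.mod_eq_of_lt hb, Nat.mod_eq_of_lt hb'] at h1
  subst h1
  refine ⟨?_, rfl⟩
  exact Nat.eq_of_mul_eq_mul_right (by omega : 0 < n) (by omega)

theorem deleteMatching_spec {n : ℕ} {s : State} (h2 : ∀ j ≤ n, s.arr 2 j = j * n)
    (h3 : ∀ v, 1 ≤ v → v ≤ n → 1 ≤ s.arr 3 v ∧ s.arr 3 v ≤ n) :
    ∀ u v, 1 ≤ u → u ≤ n → 1 ≤ v → v ≤ n →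
      (storedAdj ((deleteMatching.sem n s).arr 0) (s.arr 2) u v ↔
        storedAdj (s.arr 0) (s.arr 2) u v ∧ u ≠ s.arr 3 v) := by
  have key := sem_forTo_induct (n := n) (x := 1) (s := s)
    (c := store 0 (cellIndex (.get 3 (.reg 1)) (.reg 1)) (.lit 0))
    (fun i t => t.arr 2 = s.arr 2 ∧ t.arr 3 = s.arr 3 ∧
      ∀ u v, 1 ≤ u → u ≤ n → 1 ≤ v → v ≤ n → (storedAdj (t.arr 0) (s.arr 2) u v ↔
        storedAdj (s.arr 0) (s.arr 2) u v ∧ ¬ (v ≤ i ∧ u = s.arr 3 v)))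
    ⟨rfl, rfl, fun u v _ _ hv _ => ?_⟩ ?_
  · intro u v hu hun hv hvn
    have : storedAdj ((deleteMatching.sem n s).arr 0) (s.arr 2) u v ↔
        storedAdj (s.arr 0) (s.arr 2) u v ∧ ¬ (v ≤ n ∧ u = s.arr 3 v) :=
      key.2.2 u v hu hun hv hvn
    simpa [hvn] using this
  · have : ¬ v ≤ 0 := by omega
    simp [this]
  · intro i hi t ⟨ht2, ht3, ht⟩
    refine ⟨by simpa [sem] using ht2, by simpa [sem] using ht3, fun u v hu hun hv hvn => ?_⟩
    have hA := h3 (i + 1) (by omega) (by omega)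
    have hstep : ((store 0 (cellIndex (.get 3 (.reg 1)) (.reg 1)) (.lit 0)).sem n
        (t.setReg 1 (i + 1))).arr 0 =
        Function.update (t.arr 0) (s.arr 2 (s.arr 3 (i + 1) - 1) + (i + 1 - 1)) 0 := by
      simp [sem, Exp.eval, cellIndex, ht2, ht3]
    rw [hstep]
    by_cases hc : v = i + 1 ∧ u = s.arr 3 v
    · obtain ⟨rfl, rfl⟩ := hc
      simp [storedAdj]
    · have hne : s.arr 2 (u - 1) + (v - 1) ≠ s.arr 2 (s.arr 3 (i + 1) - 1) + (i + 1 - 1) := by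
        intro he
        rw [h2 _ (by omega), h2 _ (by omega)] at he
        have := cell_inj (by omega) (by omega) he
        obtain rfl : v = i + 1 := by omega
        exact hc ⟨rfl, by omega⟩
      have := ht u v hu hun hv hvn
      rw [storedAdj, Function.update_of_ne hne, ← storedAdj, this]
      have : (v ≤ i + 1 ∧ u = s.arr 3 v) ↔ (v ≤ i ∧ u = s.arr 3 v) := by
        constructor
        · rintro ⟨h1, h2⟩
          refine ⟨?_, h2⟩
          by_contra hlt
          exact hc ⟨by omega, h2⟩
        · rintro ⟨h1, h2⟩
          exact ⟨by omega, h2⟩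
      rw [this]

theorem countFree_spec {n : ℕ} {s : State} : (countFree.sem n s).reg 7 =
    43 * ((Finset.Icc 1 n).filter (fun v => s.arr 6 v = 0)).card := by
  have key := sem_forTo_induct (n := n) (x := 1) (s := s.setReg 7 0)
    (c := ite (.get 6 (.reg 1)) skip (assign 7 (.add (.reg 7) (.lit 43))))
    (fun i t => t.arr = s.arr ∧
      t.reg 7 = 43 * ((Finset.Icc 1 i).filter (fun v => s.arr 6 v = 0)).card)
    ⟨rfl, by simp⟩ ?_
  · exact key.2
  · intro i hi t ⟨ht, ht7⟩
    have hIcc : Finset.Icc 1 (i + 1) = insert (i + 1) (Finset.Icc 1 i) := by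
      ext x
      simp only [Finset.mem_Icc, Finset.mem_insert]
      omega
    rw [hIcc, Finset.filter_insert]
    by_cases h0 : s.arr 6 (i + 1) = 0
    · rw [if_pos h0, Finset.card_insert_of_notMem (by simp)]
      simp [sem, Exp.eval, ht, h0, ht7]
      ring
    · rw [if_neg h0]
      simp [sem, Exp.eval, ht, h0, ht7]

theorem storedAdj_inputState {n : ℕ} {E : Finset (Fin n × Fin n)} {mul : ℕ → ℕ}
    (hmul : ∀ j ≤ n, mul j = j * n) {u v : ℕ} (hu : 1 ≤ u) (hun : u ≤ n) (hv : 1 ≤ v)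
    (hvn : v ≤ n) : storedAdj ((inputState E).arr 0) mul u v ↔ IsEdge E u v := by
  simp only [storedAdj, inputState, IsEdge, hmul (u - 1) (by omega), true_and, ne_eq,
    ite_eq_right_iff, one_ne_zero, imp_false, not_not]
  refine exists_congr fun e => and_congr_right fun _ => ?_
  constructor
  · intro h
    have := cell_inj (by omega) e.2.2 h
    omega
  · rintro ⟨rfl, rfl⟩
    simp

theorem prepare_spec {n : ℕ} {E : Finset (Fin n × Fin n)} (hE : HasPerfectMatching E) {t : State}
    (ht : t = prepare.sem n (inputState E)) :
    (∃ adj', TwoMatchings n (IsEdge E) adj' (t.arr 3) (t.arr 4) (t.arr 6) (t.arr 7) (t.arr 8)) ∧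
    t.reg 7 = 43 * ((Finset.Icc 1 n).filter (fun v => t.arr 6 v = 0)).card ∧
    t.reg 0 = n ∧ ∀ i, t.arr 9 i = 0 := by
  have hs0 : (inputState E).reg 0 = n := rfl
  have hs : ∀ a i, a ≠ 0 → (inputState E).arr a i = 0 := fun a i ha => by simp [inputState, ha]
  set s := inputState E with hsdef
  obtain ⟨s₁, hs₁⟩ : ∃ s₁, s₁ = mulTable.sem n s := ⟨_, rfl⟩
  obtain ⟨s₂, hs₂⟩ : ∃ s₂, s₂ = (auction 3 4 5).sem n s₁ := ⟨_, rfl⟩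
  obtain ⟨s₃, hs₃⟩ : ∃ s₃, s₃ = deleteMatching.sem n s₂ := ⟨_, rfl⟩
  obtain ⟨s₄, hs₄⟩ : ∃ s₄, s₄ = (auction 6 7 8).sem n s₃ := ⟨_, rfl⟩
  have ht' : t = countFree.sem n s₄ := by
    rw [ht, hs₄, hs₃, hs₂, hs₁]
    rfl
  have r1 : s₁.reg 0 = n := by rw [hs₁, sem_reg_eq n _ _ (by decide), hs0]
  have r2 : s₂.reg 0 = n := by rw [hs₂, sem_reg_eq n _ _ (by decide), r1]
  have r3 : s₃.reg 0 = n := by rw [hs₃, sem_reg_eq n _ _ (by decide), r2]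
  have r4 : s₄.reg 0 = n := by rw [hs₄, sem_reg_eq n _ _ (by decide), r3]
  -- each step leaves most arrays alone
  have a1 : ∀ a, mulTable.keepsArr a = true → s₁.arr a = s.arr a :=
    fun a ha => by rw [hs₁, sem_arr_eq n _ _ ha]
  have a2 : ∀ a, (auction 3 4 5).keepsArr a = true → s₂.arr a = s₁.arr a :=
    fun a ha => by rw [hs₂, sem_arr_eq n _ _ ha]
  have a3 : ∀ a, deleteMatching.keepsArr a = true → s₃.arr a = s₂.arr a :=
    fun a ha => by rw [hs₃, sem_arr_eq n _ _ ha]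
  have a4 : ∀ a, (auction 6 7 8).keepsArr a = true → s₄.arr a = s₃.arr a :=
    fun a ha => by rw [hs₄, sem_arr_eq n _ _ ha]
  have a5 : t.arr = s₄.arr := by
    funext a
    rw [ht', sem_arr_eq n _ _ rfl]
  have hmul : ∀ j ≤ n, s₁.arr 2 j = j * n := by
    rw [hs₁]
    exact mulTable_spec hs0 (hs 2 0 (by decide))
  obtain ⟨inv₁, over₁⟩ := auction_spec (n := n) (A := 3) (O := 4) (P := 5) (s := s₁) (by decide)
    (by decide) (by decide) (by decide) (by decide) (by decide) r1
    (fun i => by rw [a1 3 (by decide)]; exact hs 3 i (by decide))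
    (fun i => by rw [a1 4 (by decide)]; exact hs 4 i (by decide))
    (fun i => by rw [a1 5 (by decide)]; exact hs 5 i (by decide))
  rw [← hs₂] at inv₁ over₁
  have hadj : ∀ u v, 1 ≤ u → u ≤ n → 1 ≤ v → v ≤ n →
      (storedAdj (s₁.arr 0) (s₁.arr 2) u v ↔ IsEdge E u v) := by
    intro u v hu hun hv hvn
    rw [a1 0 (by decide)]
    exact storedAdj_inputState hmul hu hun hv hvn
  have hperf : ∀ v, 1 ≤ v → v ≤ n → s₂.arr 3 v ≠ 0 := by
    obtain ⟨μ, hμ⟩ := hE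
    have hμ' : ∀ v (hv : v ∈ Finset.Icc 1 n), v - 1 < n := fun v hv => by
      have := Finset.mem_Icc.1 hv
      omega
    intro v hv hvn
    refine inv₁.ne_zero_of_perfect over₁
      (μ := fun v => if h : v - 1 < n then (μ.symm ⟨v - 1, h⟩ : ℕ) + 1 else 0) ?_ ?_ hv hvn
    · intro x hx
      have hx' := Finset.mem_Icc.1 hx
      simp only [hμ' x hx, dif_pos]
      refine ⟨Finset.mem_Icc.2 ⟨by omega, by omega⟩,
        (hadj _ _ (by omega) (by omega) hx'.1 hx'.2).2 ?_⟩
      have hmem := hμ (μ.symm ⟨x - 1, hμ' x hx⟩)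
      rw [Equiv.apply_symm_apply] at hmem
      exact ⟨_, hmem, rfl, by simp only; omega⟩
    · intro x hx y hy hxy
      have hx' := Finset.mem_Icc.1 (Finset.mem_coe.1 hx)
      have hy' := Finset.mem_Icc.1 (Finset.mem_coe.1 hy)
      simp only [hμ' x (Finset.mem_coe.1 hx), hμ' y (Finset.mem_coe.1 hy), dif_pos] at hxy
      have h1 := μ.symm.injective (Fin.ext (Nat.succ_injective hxy))
      have h2 := congrArg Fin.val h1
      simp only at h2
      omega
  have hmem : ∀ v, 1 ≤ v → v ≤ n → 1 ≤ s₂.arr 3 v ∧ s₂.arr 3 v ≤ n := fun v hv hvn =>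
    ⟨Nat.one_le_iff_ne_zero.2 (hperf v hv hvn), inv₁.A_le v⟩
  have hdel := deleteMatching_spec (n := n) (s := s₂)
    (by rw [a2 2 (by decide)]; exact hmul) hmem
  rw [← hs₃] at hdel
  obtain ⟨inv₂, over₂⟩ := auction_spec (n := n) (A := 6) (O := 7) (P := 8) (s := s₃) (by decide)
    (by decide) (by decide) (by decide) (by decide) (by decide) r3
    (fun i => by
      rw [a3 6 (by decide), a2 6 (by decide), a1 6 (by decide)]; exact hs 6 i (by decide))
    (fun i => by
      rw [a3 7 (by decide), a2 7 (by decide), a1 7 (by decide)]; exact hs 7 i (by decide))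
    (fun i => by
      rw [a3 8 (by decide), a2 8 (by decide), a1 8 (by decide)]; exact hs 8 i (by decide))
  rw [← hs₄] at inv₂ over₂
  refine ⟨⟨storedAdj (s₃.arr 0) (s₃.arr 2), ?_⟩, ?_, ?_, ?_⟩
  · rw [a5, a4 3 (by decide), a4 4 (by decide), a3 3 (by decide), a3 4 (by decide)]
    refine ⟨hmem, fun v hv hvn => inv₁.O_A v (hperf v hv hvn), inv₁.O_zero, ?_, ?_, inv₂, over₂⟩
    · intro v hv hvn
      exact (hadj _ _ (hmem v hv hvn).1 (hmem v hv hvn).2 hv hvn).1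
        (inv₁.adj_A v (hperf v hv hvn))
    · intro u v hu hun hv hvn
      rw [a3 2 (by decide), hdel u v hu hun hv hvn, a2 0 (by decide), a2 2 (by decide),
        hadj u v hu hun hv hvn]
  · rw [a5, ht']
    exact countFree_spec
  · rw [ht', sem_reg_eq n _ _ (by decide), r4]
  · intro i
    rw [a5, a4 9 (by decide), a3 9 (by decide), a2 9 (by decide), a1 9 (by decide)]
    exact hs 9 i (by decide)

theorem findGap_spec {n : ℕ} {s : State}
    (hgap : ∃ t, 1 ≤ t ∧ t ≤ n ∧ ∀ u, 1 ≤ u → u ≤ n → s.arr 8 u ≠ t) :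
    1 ≤ (findGap.sem n s).reg 8 ∧ (findGap.sem n s).reg 8 ≤ n ∧
      ∀ u, 1 ≤ u → u ≤ n → s.arr 8 u ≠ (findGap.sem n s).reg 8 := by
  have key := sem_forTo_induct (n := n) (x := 5) (s := s.setReg 8 0)
    (c := seq (assign 9 (.lit 0))
      (seq (forTo 2 (ite (neExp (.get 8 (.reg 2)) (.reg 5)) skip (assign 9 (.lit 1))))
        (ite (.reg 9) skip (assign 8 (.reg 5)))))
    (fun i t => t.arr = s.arr ∧
      ((1 ≤ t.reg 8 ∧ t.reg 8 ≤ i ∧ ∀ u, 1 ≤ u → u ≤ n → s.arr 8 u ≠ t.reg 8) ∨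
        ∀ p, 1 ≤ p → p ≤ i → ∃ u, 1 ≤ u ∧ u ≤ n ∧ s.arr 8 u = p))
    ⟨rfl, Or.inr fun p h1 h2 => by omega⟩ ?_
  · rcases key.2 with h | h
    · exact h
    · obtain ⟨t, h1, h2, h3⟩ := hgap
      obtain ⟨u, hu, hun, he⟩ := h t h1 h2
      exact absurd he (h3 u hu hun)
  · intro i hi t ⟨ht, ht8⟩
    -- the inner loop raises the flag in register `9` if and only if the price `i + 1` occurs
    have inner := sem_forTo_induct (n := n) (x := 2) (s := (t.setReg 5 (i + 1)).setReg 9 0)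
      (c := ite (neExp (.get 8 (.reg 2)) (.reg 5)) skip (assign 9 (.lit 1)))
      (fun j r => r.arr = s.arr ∧ r.reg 5 = i + 1 ∧ r.reg 8 = t.reg 8 ∧
        (r.reg 9 ≠ 0 ↔ ∃ u, 1 ≤ u ∧ u ≤ j ∧ s.arr 8 u = i + 1))
      ⟨by simpa using ht, by simp, by simp, by
        simp only [State.setReg_reg]
        grind⟩ ?_
    · obtain ⟨k1, k2, k3, k4⟩ := inner
      set r := (forTo 2 (ite (neExp (.get 8 (.reg 2)) (.reg 5)) skip (assign 9 (.lit 1)))).sem n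
        ((t.setReg 5 (i + 1)).setReg 9 0) with hr
      have hstep : (seq (assign 9 (.lit 0))
          (seq (forTo 2 (ite (neExp (.get 8 (.reg 2)) (.reg 5)) skip (assign 9 (.lit 1))))
            (ite (.reg 9) skip (assign 8 (.reg 5))))).sem n (t.setReg 5 (i + 1)) =
          if r.reg 9 ≠ 0 then r else r.setReg 8 (i + 1) := by
        have : (seq (assign 9 (.lit 0))
            (seq (forTo 2 (ite (neExp (.get 8 (.reg 2)) (.reg 5)) skip (assign 9 (.lit 1))))
              (ite (.reg 9) skip (assign 8 (.reg 5))))).sem n (t.setReg 5 (i + 1)) =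
            (ite (.reg 9) skip (assign 8 (.reg 5))).sem n r := rfl
        rw [this]
        simp only [sem, Exp.eval, k2]
      rw [hstep]
      by_cases h9 : r.reg 9 = 0
      · rw [if_neg (by simpa using h9)]
        refine ⟨by simpa using k1, Or.inl ⟨by simp, by simp, ?_⟩⟩
        intro u hu hun he
        exact (k4.2 ⟨u, hu, hun, by simpa using he⟩) h9
      · rw [if_pos h9, k3]
        refine ⟨k1, ?_⟩
        rcases ht8 with ⟨h1, h2, h3⟩ | h1
        · exact Or.inl ⟨h1, by omega, h3⟩
        · refine Or.inr fun p hp hpi => ?_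
          rcases Nat.lt_or_ge i p with hlt | hge
          · obtain rfl : p = i + 1 := by omega
            exact k4.1 h9
          · exact h1 p hp hge
    · intro j hj r ⟨k1, k2, k3, k4⟩
      have hev : (neExp (.get 8 (.reg 2)) (.reg 5)).eval (r.setReg 2 (j + 1)) ≠ 0 ↔
          s.arr 8 (j + 1) ≠ i + 1 := by
        rw [eval_neExp]
        simp [Exp.eval, k1, k2]
      have hext : (∃ u, 1 ≤ u ∧ u ≤ j + 1 ∧ s.arr 8 u = i + 1) ↔
          (∃ u, 1 ≤ u ∧ u ≤ j ∧ s.arr 8 u = i + 1) ∨ s.arr 8 (j + 1) = i + 1 := by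
        constructor
        · rintro ⟨u, h1, h2, h3⟩
          rcases Nat.lt_or_ge j u with hlt | hge
          · obtain rfl : u = j + 1 := by omega
            exact Or.inr h3
          · exact Or.inl ⟨u, h1, hge, h3⟩
        · rintro (⟨u, h1, h2, h3⟩ | h)
          · exact ⟨u, h1, by omega, h3⟩
          · exact ⟨j + 1, by omega, le_rfl, h⟩
      rw [hext]
      simp only [sem, hev]
      split_ifs with hc
      · exact ⟨by simpa using k1, by simpa using k2, by simpa using k3, by simpa [hc] using k4⟩
      · push Not at hc
        exact ⟨by simpa using k1, by simpa using k2, by simpa using k3, by simp [Exp.eval, hc]⟩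

theorem gapKeys_spec {n : ℕ} {s : State} (h0 : s.reg 0 = n) (h8 : s.reg 8 ≤ n)
    (hA : ∀ v, 1 ≤ v → v ≤ n → s.arr 3 v ≠ 0) : ∀ v, 1 ≤ v → v ≤ n →
    (gapKeys.sem n s).arr 10 v = if s.arr 6 v = 0 ∨ s.reg 8 < s.arr 8 (s.arr 6 v) then
      (if s.reg 8 < s.arr 8 (s.arr 3 v) then 0 else 1) else 2 := by
  have key := sem_forTo_induct (n := n) (x := 1) (s := s.setArr 8 0 (n + 1))
    (c := ite (.sub (.get 8 (.get 6 (.reg 1))) (.reg 8))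
      (ite (.sub (.get 8 (.get 3 (.reg 1))) (.reg 8))
        (store 10 (.reg 1) (.lit 0)) (store 10 (.reg 1) (.lit 1)))
      (store 10 (.reg 1) (.lit 2)))
    (fun i t => t.reg 8 = s.reg 8 ∧ t.arr 3 = s.arr 3 ∧ t.arr 6 = s.arr 6 ∧
      t.arr 8 = Function.update (s.arr 8) 0 (n + 1) ∧
      ∀ v, 1 ≤ v → v ≤ i → t.arr 10 v =
        if s.arr 6 v = 0 ∨ s.reg 8 < s.arr 8 (s.arr 6 v) then
          (if s.reg 8 < s.arr 8 (s.arr 3 v) then 0 else 1) else 2)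
    ⟨by simp, by simp, by simp, by simp, fun v h1 h2 => by omega⟩ ?_
  · have hstep : gapKeys.sem n s = (forTo 1 (ite (.sub (.get 8 (.get 6 (.reg 1))) (.reg 8))
      (ite (.sub (.get 8 (.get 3 (.reg 1))) (.reg 8))
        (store 10 (.reg 1) (.lit 0)) (store 10 (.reg 1) (.lit 1)))
      (store 10 (.reg 1) (.lit 2)))).sem n (s.setArr 8 0 (n + 1)) := by
      rw [← h0]
      rfl
    rw [hstep]
    exact key.2.2.2.2
  · intro i hi t ⟨k1, k2, k3, k4, k5⟩
    have e1 : Exp.eval (t.setReg 1 (i + 1)) (.sub (.get 8 (.get 6 (.reg 1))) (.reg 8)) ≠ 0 ↔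
        s.arr 6 (i + 1) = 0 ∨ s.reg 8 < s.arr 8 (s.arr 6 (i + 1)) := by
      simp only [Exp.eval, State.setReg_reg, State.setReg_arr, if_true, k1, k3, k4]
      by_cases hc : s.arr 6 (i + 1) = 0
      · simp [hc]
        omega
      · simp [hc]
        omega
    have e2 : Exp.eval (t.setReg 1 (i + 1)) (.sub (.get 8 (.get 3 (.reg 1))) (.reg 8)) ≠ 0 ↔
        s.reg 8 < s.arr 8 (s.arr 3 (i + 1)) := by
      simp [Exp.eval, k1, k2, k4, hA (i + 1) (by omega) (by omega)]
      omega
    simp only [sem, e1, e2]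
    have hold : ∀ v c, v ≤ i → ((t.setReg 1 (i + 1)).setArr 10 (i + 1) c).arr 10 v =
        t.arr 10 v := fun v c hv => by
      have : v ≠ i + 1 := by omega
      simp [this]
    split_ifs with c1 c2
    all_goals
      refine ⟨by simpa using k1, by simpa using k2, by simpa using k3, by simpa using k4, ?_⟩
      intro v hv hvi
      rcases Nat.lt_or_ge i v with hlt | hge
      · obtain rfl : v = i + 1 := by omega
        simp [Exp.eval, *]
      · rw [← k5 v hv hge]
        simpa [Exp.eval] using hold v _ hge

theorem independentSet_spec {n : ℕ} {adj adj' : ℕ → ℕ → Prop} {s : State}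
    (h : TwoMatchings n adj adj' (s.arr 3) (s.arr 4) (s.arr 6) (s.arr 7) (s.arr 8))
    (h9 : ∀ i, s.arr 9 i = 0) {F : ℕ → ℕ} (hF : F = (independentSet.sem n s).arr 9) :
    F 0 = 0 ∧ (∀ v, F v ≠ 0 → F (s.arr 4 (s.arr 6 v)) = 0) ∧
      ∀ v, 1 ≤ v → v ≤ n → F v = 0 →
        F (s.arr 4 (s.arr 6 v)) ≠ 0 ∨ F (s.arr 7 (s.arr 3 v)) ≠ 0 := by
  have key := sem_forTo_induct (n := n) (x := 1) (s := s)
    (c := ite (.add (.get 9 (.get 4 (.get 6 (.reg 1)))) (.get 9 (.get 7 (.get 3 (.reg 1)))))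
      skip (store 9 (.reg 1) (.lit 1)))
    (fun i t => (t.arr 3 = s.arr 3 ∧ t.arr 4 = s.arr 4 ∧ t.arr 6 = s.arr 6 ∧ t.arr 7 = s.arr 7) ∧
      (∀ v, t.arr 9 v ≠ 0 → 1 ≤ v ∧ v ≤ i) ∧
      (∀ v, t.arr 9 v ≠ 0 → t.arr 9 (s.arr 4 (s.arr 6 v)) = 0) ∧
      ∀ v, 1 ≤ v → v ≤ i → t.arr 9 v = 0 →
        t.arr 9 (s.arr 4 (s.arr 6 v)) ≠ 0 ∨ t.arr 9 (s.arr 7 (s.arr 3 v)) ≠ 0)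
    ⟨⟨rfl, rfl, rfl, rfl⟩, by simp [h9], by simp [h9], fun v h1 h2 => by omega⟩ ?_
  · rw [hF]
    obtain ⟨-, k1, k2, k3⟩ := key
    refine ⟨?_, k2, k3⟩
    by_contra h0
    have := k1 0 h0
    omega
  · intro i hi t ⟨⟨a3, a4, a6, a7⟩, k1, k2, k3⟩
    have e1 : Exp.eval (t.setReg 1 (i + 1)) (.add (.get 9 (.get 4 (.get 6 (.reg 1))))
        (.get 9 (.get 7 (.get 3 (.reg 1))))) ≠ 0 ↔
        t.arr 9 (s.arr 4 (s.arr 6 (i + 1))) ≠ 0 ∨ t.arr 9 (s.arr 7 (s.arr 3 (i + 1))) ≠ 0 := by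
      simp only [Exp.eval, State.setReg_reg, State.setReg_arr, if_true, a3, a4, a6, a7]
      omega
    simp only [sem, e1]
    split_ifs with hc
    · refine ⟨⟨a3, a4, a6, a7⟩, fun v hv => ?_, k2, fun v hv hvi h0 => ?_⟩
      · have := k1 v hv
        omega
      · rcases Nat.lt_or_ge i v with hlt | hge
        · obtain rfl : v = i + 1 := by omega
          exact hc
        · exact k3 v hv hge h0
    · push Not at hc
      have hnew : ∀ v, ((t.setReg 1 (i + 1)).setArr 9 ((Exp.reg 1).eval (t.setReg 1 (i + 1)))
          ((Exp.lit 1).eval (t.setReg 1 (i + 1)))).arr 9 v =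
          if v = i + 1 then 1 else t.arr 9 v := by
        intro v
        simp [Exp.eval, Function.update_apply]
      have hne : s.arr 4 (s.arr 6 (i + 1)) ≠ i + 1 := by
        intro he
        have hA : s.arr 6 (i + 1) ≠ 0 := fun h0 => by
          rw [h0, h.O_zero] at he
          omega
        have hA1 := Nat.one_le_iff_ne_zero.2 hA
        have hAn := h.inv.A_le (i + 1)
        have h1 := (h.adj_iff _ _ hA1 hAn (by omega) (by omega)).1 (h.inv.adj_A _ hA)
        have h2 := (h.O_mem hA1 hAn).2.2
        rw [he] at h2
        exact h1.2 h2.symm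
      refine ⟨⟨by simpa using a3, by simpa using a4, by simpa using a6, by simpa using a7⟩, ?_, ?_, ?_⟩
      · intro v hv
        rw [hnew] at hv
        split_ifs at hv with hvi
        · omega
        · have := k1 v hv
          omega
      · intro v hv
        rw [hnew] at hv ⊢
        by_cases hvi : v = i + 1
        · rw [hvi, if_neg hne]
          exact hc.1
        · rw [if_neg hvi] at hv
          have hfv : s.arr 4 (s.arr 6 v) ≠ i + 1 := by
            intro he
            have hA : s.arr 6 v ≠ 0 := fun h0 => by
              rw [h0, h.O_zero] at he
              omega
            have h2 := (h.O_mem (Nat.one_le_iff_ne_zero.2 hA) (h.inv.A_le v)).2.2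
            rw [he] at h2
            exact hv (by rw [← h.inv.O_A v hA, ← h2]; exact hc.2)
          rw [if_neg hfv]
          exact k2 v hv
      · intro v hv hvi h0
        rw [hnew] at h0
        split_ifs at h0 with hvi'
        simp only [hnew]
        have hv' := k3 v hv (by omega) h0
        refine hv'.imp ?_ ?_ <;>
        · intro hx
          split_ifs
          · decide
          · exact hx

theorem independentKeys_spec {n : ℕ} {s : State} : ∀ v, 1 ≤ v → v ≤ n →
    (independentKeys.sem n s).arr 10 v = if s.arr 9 v ≠ 0 then
      (if s.arr 9 (s.arr 7 (s.arr 3 (s.arr 7 (s.arr 3 v)))) ≠ 0 then 1 else 0) else 2 := by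
  have key := sem_forTo_induct (n := n) (x := 1) (s := s)
    (c := ite (.get 9 (.reg 1))
      (ite (.get 9 (.get 7 (.get 3 (.get 7 (.get 3 (.reg 1))))))
        (store 10 (.reg 1) (.lit 1)) (store 10 (.reg 1) (.lit 0)))
      (store 10 (.reg 1) (.lit 2)))
    (fun i t => t.arr 3 = s.arr 3 ∧ t.arr 7 = s.arr 7 ∧ t.arr 9 = s.arr 9 ∧
      ∀ v, 1 ≤ v → v ≤ i → t.arr 10 v = if s.arr 9 v ≠ 0 then
        (if s.arr 9 (s.arr 7 (s.arr 3 (s.arr 7 (s.arr 3 v)))) ≠ 0 then 1 else 0) else 2)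
    ⟨rfl, rfl, rfl, fun v h1 h2 => by omega⟩ ?_
  · exact key.2.2.2
  · intro i hi t ⟨k1, k2, k3, k5⟩
    have e1 : Exp.eval (t.setReg 1 (i + 1)) (.get 9 (.reg 1)) = s.arr 9 (i + 1) := by
      simp [Exp.eval, k3]
    have e2 : Exp.eval (t.setReg 1 (i + 1)) (.get 9 (.get 7 (.get 3 (.get 7 (.get 3 (.reg 1)))))) =
        s.arr 9 (s.arr 7 (s.arr 3 (s.arr 7 (s.arr 3 (i + 1))))) := by
      simp [Exp.eval, k1, k2, k3]
    simp only [sem, e1, e2]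
    have hold : ∀ v c, v ≤ i → ((t.setReg 1 (i + 1)).setArr 10 (i + 1) c).arr 10 v =
        t.arr 10 v := fun v c hv => by
      have : v ≠ i + 1 := by omega
      simp [this]
    split_ifs with c1 c2
    all_goals
      refine ⟨by simpa using k1, by simpa using k2, by simpa using k3, ?_⟩
      intro v hv hvi
      rcases Nat.lt_or_ge i v with hlt | hge
      · obtain rfl : v = i + 1 := by omega
        simp [Exp.eval, *]
      · rw [← k5 v hv hge]
        simpa [Exp.eval] using hold v _ hge

/-- The output written so far, up to the position in register `10`, is the list `l`. -/
def HasOutput (s : State) (l : List ℕ) : Prop :=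
  s.reg 10 = l.length ∧ ∀ i < l.length, l[i]? = some (s.arr 1 i)

theorem collect_spec {n c : ℕ} {s : State} {l : List ℕ} (h : HasOutput s l) :
    HasOutput ((collect c).sem n s)
      (l ++ (List.range n).filter (fun v => s.arr 10 (v + 1) = c)) := by
  refine (sem_forTo_induct (fun i t => t.arr 10 = s.arr 10 ∧
    HasOutput t (l ++ (List.range i).filter (fun v => s.arr 10 (v + 1) = c))) ?_ ?_).2
  · exact ⟨rfl, by simpa [HasOutput] using h⟩
  · intro i hi t ⟨ht10, ht, htl⟩
    have hev : (neExp (.get 10 (.reg 1)) (.lit c)).eval (t.setReg 1 (i + 1)) ≠ 0 ↔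
        s.arr 10 (i + 1) ≠ c := by
      rw [eval_neExp]
      simp [Exp.eval, ht10]
    simp only [sem, hev]
    rw [List.range_succ, List.filter_append, ← List.append_assoc]
    set l' := l ++ (List.range i).filter (fun v => s.arr 10 (v + 1) = c)
    split_ifs with hc
    · rw [List.filter_cons_of_neg (by simpa using hc)]
      refine ⟨by simpa using ht10, ?_⟩
      simpa [HasOutput] using ⟨ht, htl⟩
    · push Not at hc
      rw [List.filter_cons_of_pos (by simpa using hc), List.filter_nil]
      refine ⟨by simpa [Exp.eval] using ht10, by simp [Exp.eval, ht], ?_⟩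
      intro j hj
      rw [List.length_append, List.length_singleton] at hj
      rcases Nat.lt_or_ge j l'.length with hlt | hge
      · have hne : j ≠ l'.length := by omega
        rw [List.getElem?_append_left hlt, htl j hlt]
        simp [Exp.eval, ht, hne]
      · obtain rfl : j = l'.length := by omega
        simp [Exp.eval, ht]

theorem output_spec {n : ℕ} {s : State} :
    HasOutput (output.sem n s)
      ((List.range n).filter (fun v => s.arr 10 (v + 1) = 0) ++
        (List.range n).filter (fun v => s.arr 10 (v + 1) = 1) ++
        (List.range n).filter (fun v => s.arr 10 (v + 1) = 2)) := by
  have h0 : HasOutput (s.setReg 10 0) [] := ⟨by simp, by simp⟩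
  have h1 := collect_spec (n := n) (c := 0) h0
  have h2 := collect_spec (n := n) (c := 1) h1
  have h3 := collect_spec (n := n) (c := 2) h2
  rw [sem_arr_eq n _ _ (by decide), sem_arr_eq n _ _ (by decide)] at h3
  rw [sem_arr_eq n _ _ (by decide)] at h3
  rw [List.nil_append] at h3
  exact h3

end ForProg

/-! ### Correctness of the algorithm -/

namespace ForProg

theorem priorities_spec {n : ℕ} {adj adj' : ℕ → ℕ → Prop} {s : State} (h0 : s.reg 0 = n)
    (h : TwoMatchings n adj adj' (s.arr 3) (s.arr 4) (s.arr 6) (s.arr 7) (s.arr 8))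
    (h7 : s.reg 7 = 43 * ((Finset.Icc 1 n).filter (fun v => s.arr 6 v = 0)).card)
    (h9 : ∀ i, s.arr 9 i = 0) :
    GoodKey n adj (s.arr 3) ((priorities.sem n s).arr 10) ∧
      ∀ v, 1 ≤ v → v ≤ n → (priorities.sem n s).arr 10 v ≤ 2 := by
  have hA : ∀ v, 1 ≤ v → v ≤ n → s.arr 3 v ≠ 0 := fun v hv hvn =>
    Nat.one_le_iff_ne_zero.1 (h.A_mem v hv hvn).1
  have hev : Exp.eval s (.sub (.add (.reg 7) (.lit 1)) (.reg 0)) ≠ 0 ↔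
      n ≤ 43 * ((Finset.Icc 1 n).filter (fun v => s.arr 6 v = 0)).card := by
    simp only [Exp.eval, h0, h7]
    omega
  by_cases hc : n ≤ 43 * ((Finset.Icc 1 n).filter (fun v => s.arr 6 v = 0)).card
  · have hstep : priorities.sem n s = gapKeys.sem n (findGap.sem n s) := by
      simp only [priorities, sem, if_pos (hev.2 hc)]
    rw [hstep]
    have harr : (findGap.sem n s).arr = s.arr := by
      funext a
      exact sem_arr_eq n _ _ rfl
    rcases Nat.eq_zero_or_pos n with hn | hn
    · subst hn
      exact ⟨fun _ _ _ _ => Nat.zero_le _, fun v h1 h2 => by omega⟩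
    have hpos : 0 < ((Finset.Icc 1 n).filter (fun v => s.arr 6 v = 0)).card := by omega
    obtain ⟨v, hv⟩ := Finset.card_pos.1 hpos
    rw [Finset.mem_filter, Finset.mem_Icc] at hv
    obtain ⟨h1, h2, h3⟩ := findGap_spec (h.inv.exists_gap hv.1.1 hv.1.2 hv.2)
    have hkeys := gapKeys_spec (n := n) (s := findGap.sem n s)
      (by rw [sem_reg_eq n _ _ (by decide), h0]) h2 (by rw [harr]; exact hA)
    rw [harr] at hkeys
    refine ⟨h.goodKey_of_gap h2 h3 hc hkeys, fun v hv hvn => ?_⟩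
    rw [hkeys v hv hvn]
    split_ifs <;> omega
  · have hstep : priorities.sem n s = independentKeys.sem n (independentSet.sem n s) := by
      simp only [priorities, sem, if_neg (fun he => hc (hev.1 he))]
    rw [hstep]
    obtain ⟨k1, k2, k3⟩ := independentSet_spec h h9 rfl
    have hkeys := independentKeys_spec (n := n) (s := independentSet.sem n s)
    rw [sem_arr_eq (a := 3) n _ s (by decide), sem_arr_eq (a := 7) n _ s (by decide)] at hkeys
    refine ⟨h.goodKey_of_independent k1 (by omega) k2 k3 hkeys, fun v hv hvn => ?_⟩
    rw [hkeys v hv hvn]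
    split_ifs <;> omega

/-- If the vertices are output by increasing priority, then the output is a permutation that
respects the priorities. -/
theorem exists_perm_of_hasOutput {n : ℕ} {s : State} {key : ℕ → ℕ}
    (hkey : ∀ v, 1 ≤ v → v ≤ n → key v ≤ 2)
    (h : HasOutput s ((List.range n).filter (fun v => key (v + 1) = 0) ++
        (List.range n).filter (fun v => key (v + 1) = 1) ++
        (List.range n).filter (fun v => key (v + 1) = 2))) :
    ∃ π : Fin n ≃ Fin n, Outputs s π ∧
      ∀ a b, π.symm a < π.symm b → key (a + 1) ≤ key (b + 1) := by
  set l := (List.range n).filter (fun v => key (v + 1) = 0) ++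
    (List.range n).filter (fun v => key (v + 1) = 1) ++
    (List.range n).filter (fun v => key (v + 1) = 2) with hl
  have hmem : ∀ v, v ∈ l ↔ v ∈ List.range n := by
    intro v
    simp only [hl, List.mem_append, List.mem_filter, List.mem_range, decide_eq_true_eq]
    constructor
    · tauto
    · intro hv
      have := hkey (v + 1) (by omega) (by omega)
      have : key (v + 1) = 0 ∨ key (v + 1) = 1 ∨ key (v + 1) = 2 := by omega
      tauto
  have hnodup : l.Nodup := by
    have hr : ∀ p : ℕ → Bool, ((List.range n).filter p).Nodup := fun p =>
      List.nodup_range.filter p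
    rw [hl, List.nodup_append, List.nodup_append]
    refine ⟨⟨hr _, hr _, ?_⟩, hr _, ?_⟩
    · intro a ha b hb hab
      simp only [List.mem_filter, decide_eq_true_eq] at ha hb
      rw [hab] at ha
      omega
    · intro a ha b hb hab
      simp only [List.mem_append, List.mem_filter, decide_eq_true_eq] at ha hb
      rw [hab] at ha
      omega
  have hsorted : l.Pairwise (fun a b => key (a + 1) ≤ key (b + 1)) := by
    have hr : ∀ c, ((List.range n).filter (fun v => key (v + 1) = c)).Pairwise
        (fun a b => key (a + 1) ≤ key (b + 1)) := by
      intro c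
      rw [List.pairwise_iff_getElem]
      intro i j hi hj _
      have ha := (List.mem_filter.1 (List.getElem_mem hi)).2
      have hb := (List.mem_filter.1 (List.getElem_mem hj)).2
      rw [decide_eq_true_eq] at ha hb
      exact (ha.trans hb.symm).le
    rw [hl, List.pairwise_append, List.pairwise_append]
    refine ⟨⟨hr _, hr _, ?_⟩, hr _, ?_⟩
    · intro a ha b hb
      simp only [List.mem_filter, decide_eq_true_eq] at ha hb
      omega
    · intro a ha b hb
      simp only [List.mem_append, List.mem_filter, decide_eq_true_eq] at ha hb
      omega
  have hlen : l.length = n := by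
    have := ((List.perm_ext_iff_of_nodup hnodup List.nodup_range).2 hmem).length_eq
    simpa using this
  have hlt : ∀ i (hi : i < l.length), l[i] < n := fun i hi =>
    List.mem_range.1 ((hmem _).1 (List.getElem_mem hi))
  have hinj : Function.Injective
      (fun i : Fin n => (⟨l[(i : ℕ)], hlt i (by omega)⟩ : Fin n)) := by
    intro i j hij
    have := congrArg Fin.val hij
    exact Fin.ext ((List.Nodup.getElem_inj_iff hnodup).1 this)
  refine ⟨Equiv.ofBijective _ (Finite.injective_iff_bijective.1 hinj), ?_, ?_⟩
  · intro i
    have := h.2 i (by omega)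
    rw [List.getElem?_eq_getElem (by omega)] at this
    exact (Option.some_injective _ this).symm
  · intro a b hab
    set π := Equiv.ofBijective _ (Finite.injective_iff_bijective.1 hinj) with hπ
    have hval : ∀ c : Fin n, (c : ℕ) = l[(π.symm c : ℕ)] := fun c =>
      congrArg Fin.val (π.apply_symm_apply c).symm
    rw [hval a, hval b]
    exact List.pairwise_iff_getElem.1 hsorted _ _ _ _ hab

end ForProg

theorem greedyOrder_spec {n : ℕ} {E : Finset (Fin n × Fin n)} (hE : HasPerfectMatching E) :
    ∃ π : Fin n ≃ Fin n, Outputs (ForProg.greedyOrder.sem n (inputState E)) π ∧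
      ∀ M, IsGreedyOutcome E π M → 44 * n ≤ 86 * M.card := by
  obtain ⟨⟨adj', h⟩, h7, h0, h9⟩ := ForProg.prepare_spec hE rfl
  obtain ⟨hgood, hle⟩ := ForProg.priorities_spec h0 h h7 h9
  obtain ⟨π, hout, hπ⟩ := ForProg.exists_perm_of_hasOutput hle (ForProg.output_spec (n := n))
  exact ⟨π, hout, fun M hM => hM.card_ge h hgood hπ⟩

theorem cast_bound {n k : ℕ} (h : 44 * n ≤ 86 * k) :
    ((1 : ℝ) / 2 + 1 / 86) * (n : ℝ) ≤ (k : ℝ) := by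
  have : (44 : ℝ) * n ≤ 86 * k := by exact_mod_cast h
  linarith

theorem computableInPolyTime : ComputableInPolyTime ((1 : ℝ) / 2 + 1 / 86) := by
  refine ⟨ForProg.greedyOrder.toProg, ForProg.greedyOrder.time, fun n E hE => ?_⟩
  obtain ⟨t, ht, hexec⟩ := ForProg.exists_exec n ForProg.greedyOrder (inputState E) (by decide)
    (by decide) rfl
  obtain ⟨π, hout, hπ⟩ := greedyOrder_spec hE
  exact ⟨t, _, π, hexec, ht, hout,
    fun σ => cast_bound (hπ _ (isGreedyOutcome_greedyMatching E σ π))⟩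

/-- Outcomes are preserved when the vertices are renamed. -/
theorem IsGreedyOutcome.map {U V U' V' : Type*} [DecidableEq U] [DecidableEq V] [DecidableEq U']
    [DecidableEq V'] {m : ℕ} {E M : Finset (U × V)} {π : Fin m ≃ V} (h : IsGreedyOutcome E π M)
    (eU : U ≃ U') (eV : V ≃ V') :
    IsGreedyOutcome (E.map (eU.prodCongr eV).toEmbedding) (π.trans eV)
      (M.map (eU.prodCongr eV).toEmbedding) := by
  have hmem : ∀ (S : Finset (U × V)) u v,
      (u, v) ∈ S.map (eU.prodCongr eV).toEmbedding ↔ (eU.symm u, eV.symm v) ∈ S := by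
    intro S u v
    rw [Finset.mem_map_equiv]
    rfl
  refine ⟨Finset.map_subset_map.2 h.subset, ?_, ?_, ?_⟩
  · intro u v v' h1 h2
    rw [hmem] at h1 h2
    exact eV.symm.injective (h.left_inj _ _ _ h1 h2)
  · intro u u' v h1 h2
    rw [hmem] at h1 h2
    exact eU.symm.injective (h.right_inj _ _ _ h1 h2)
  · intro u v huv hfree
    rw [hmem] at huv
    obtain ⟨v', hv', hlt⟩ := h.lower _ _ huv (fun e he hev => by
      refine hfree (eU e.1, eV e.2) ((hmem _ _ _).2 (by simpa using he)) ?_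
      simp [hev])
    exact ⟨eV v', (hmem _ _ _).2 (by simpa using hv'), by simpa using hlt⟩

theorem exists_order {U V : Type*} [Fintype U] [Fintype V] [DecidableEq U] [DecidableEq V]
    (E : Finset (U × V)) (hE : HasPerfectMatching E) :
    ∃ π : Fin (Fintype.card V) ≃ V, ∀ σ : Fin (Fintype.card U) ≃ U,
      44 * Fintype.card V ≤ 86 * (greedyMatching E σ π).card := by
  obtain ⟨μ, hμ⟩ := hE
  set eV := Fintype.equivFin V
  set eU := μ.trans eV
  have hE' : HasPerfectMatching (E.map (eU.prodCongr eV).toEmbedding) := by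
    refine ⟨Equiv.refl _, fun u => ?_⟩
    rw [Finset.mem_map_equiv]
    have := hμ (eU.symm u)
    simpa [eU] using this
  obtain ⟨π, -, hπ⟩ := greedyOrder_spec hE'
  refine ⟨π.trans eV.symm, fun σ => ?_⟩
  have h := (isGreedyOutcome_greedyMatching E σ (π.trans eV.symm)).map eU eV
  have hπ' : (π.trans eV.symm).trans eV = π := by
    ext i
    simp
  rw [hπ'] at h
  simpa using hπ _ h

theorem le_rhoGraph {U V : Type*} [Fintype U] [Fintype V] [DecidableEq U] [DecidableEq V]
    [Nonempty V] (E : Finset (U × V)) (hE : HasPerfectMatching E) :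
    (1 : ℝ) / 2 + 1 / 86 ≤ rhoGraph E := by
  obtain ⟨π, hπ⟩ := exists_order E hE
  have hpos : (0 : ℝ) < Fintype.card V := by exact_mod_cast Fintype.card_pos
  rw [rhoGraph, le_div_iff₀ hpos]
  refine cast_bound ?_
  have : Nonempty (Fin (Fintype.card U) ≃ U) := ⟨(Fintype.equivFin U).symm⟩
  obtain ⟨σ, hσ⟩ := exists_eq_ciInf_of_finite
    (f := fun σ : Fin (Fintype.card U) ≃ U => (greedyMatching E σ π).card)
  have hle := le_ciSup (Set.finite_range (fun π : Fin (Fintype.card V) ≃ V =>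
    ⨅ σ : Fin (Fintype.card U) ≃ U, (greedyMatching E σ π).card)).bddAbove π
  have h1 := hπ σ
  rw [hσ] at h1
  omega

theorem le_rho : (1 : ℝ) / 2 + 1 / 86 ≤ rho := by
  refine le_csInf ⟨_, 1, Finset.univ, one_pos, ⟨Equiv.refl _, fun _ => Finset.mem_univ _⟩, rfl⟩ ?_
  rintro r ⟨n, E, hn, hE, rfl⟩
  have : Nonempty (Fin n) := ⟨⟨0, hn⟩⟩
  exact le_rhoGraph E hE

end MaxMinGreedy

theorem theorem1 :
    -- some permutation of `V` guarantees at least `(1/2 + 1/86) n` edges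
    (∀ (U V : Type*) [Fintype U] [Fintype V] [DecidableEq U] [DecidableEq V]
        (E : Finset (U × V)), MaxMinGreedy.HasPerfectMatching E →
      ∃ π : Fin (Fintype.card V) ≃ V, ∀ σ : Fin (Fintype.card U) ≃ U,
        ((1 : ℝ) / 2 + 1 / 86) * (Fintype.card V : ℝ) ≤
          ((MaxMinGreedy.greedyMatching E σ π).card : ℝ)) ∧
    -- every `ρ[G]` is at least `1/2 + 1/86`
    (∀ (U V : Type*) [Fintype U] [Fintype V] [DecidableEq U] [DecidableEq V] [Nonempty V]
        (E : Finset (U × V)), MaxMinGreedy.HasPerfectMatching E →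
      (1 : ℝ) / 2 + 1 / 86 ≤ MaxMinGreedy.rhoGraph E) ∧
    -- the constant `ρ`
    ((1 : ℝ) / 2 + 1 / 86 ≤ MaxMinGreedy.rho ∧ (51 : ℝ) / 100 < MaxMinGreedy.rho) ∧
    -- such a permutation can be computed in polynomial time
    MaxMinGreedy.ComputableInPolyTime ((1 : ℝ) / 2 + 1 / 86) := by
  refine ⟨?_, ?_, ⟨MaxMinGreedy.le_rho, ?_⟩, MaxMinGreedy.computableInPolyTime⟩
  · intro U V _ _ _ _ E hE
    obtain ⟨π, hπ⟩ := MaxMinGreedy.exists_order E hE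
    exact ⟨π, fun σ => MaxMinGreedy.cast_bound (hπ σ)⟩
  · intro U V _ _ _ _ _ E hE
    exact MaxMinGreedy.le_rhoGraph E hE
  · have := MaxMinGreedy.le_rho
    norm_num at this ⊢
    linarith
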